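/- Let $\nu_1,\nu_2,\nu_3,\nu_4$ be real constants with $1+\nu_3+\nu_4\neq 0$, and put $a=\dfrac{\nu_1+\nu_2}{2(1+\nu_3+\nu_4)}$. Let $g$ be the Euclidean metric on $\mathbb R^3$. Tensor fields are real and identified when equal almost everywhere. A symmetric 2-tensor field $f=(f_{jk})\in L^2(\mathbb R^3)$ is solenoidal if $(\delta f)_j=\sum_k\partial_kf_{jk}=0$ in the sense of distributions. The ray transform is $$(Iu)(x,\xi)=\int_{-\infty}^{\infty}\sum_{j,k}u_{jk}(x+t\xi)\,\xi^j\xi^k\,dt ,$$ and $Iu=0$ means that for almost every line this integral converges absolutely and equals zero. The solenoidal part $S(u)\in L^2$ of a symmetric 2-tensor field $u\in L^2(\mathbb R^3)$ is the solenoidal symmetric field $w$ such that $u=w+dv$, where $(dv)_{jk}=\frac12(\partial_jv_k+\partial_kv_j)$ in the sense of distributions, for some locally integrable covector field $v$ vanishing at infinity (i.e. $\{|v|>\varepsilon\}$ has finite volume for every $\varepsilon>0$). (1) Uniqueness: the implication "$I(f+a(\operatorname{tr}f)g)=0\Rightarrow f=0$" holds for all compactly supported solenoidal symmetric 2-tensor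 fields $f\in L^2(\mathbb R^3)$ if and only if $\nu_1+\nu_2+\nu_3+\nu_4\neq-1$. (2) Suppose $\nu_1+\nu_2+\nu_3+\nu_4=-1$. (a) A compactly supported solenoidal symmetric field $f\in L^2(\mathbb R^3)$ satisfies $I(f+a(\operatorname{tr}f)g)=0$ if and only if $f=S(\alpha g)$ for some compactly supported scalar function $\alpha\in L^2(\mathbb R^3)$. (b) Without the requirement of compact support, the space of all solenoidal symmetric fields $f\in L^2(\mathbb R^3)$ with $I(f+a(\operatorname{tr}f)g)=0$ is exactly $\{S(\alpha g):\alpha\in L^2(\mathbb R^3)\}$. Here $\alpha$ is arbitrary: for every scalar $\alpha\in L^2(\mathbb R^3)$ the field $S(\alpha g)$ exists and is unique, and $\operatorname{tr}S(\alpha g)=2\alpha$. -/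

import Mathlib

open MeasureTheory
open scoped ContDiff

noncomputable section

/-- Three-dimensional Euclidean space. -/
abbrev E3 : Type := EuclideanSpace ℝ (Fin 3)

/-- A 2-tensor field on `ℝ³`, by its Cartesian components `f x j k`.
The Euclidean metric tensor is the identity matrix `1`. -/
abbrev TensorField : Type := E3 → Matrix (Fin 3) (Fin 3) ℝ

/-- The partial derivative `∂φ/∂x_k` at `x`. -/
def partialDeriv (k : Fin 3) (φ : E3 → ℝ) (x : E3) : ℝ :=
  fderiv ℝ φ x (EuclideanSpace.single k 1)

/-- Test functions: smooth with compact support. -/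
def IsTestFunction (φ : E3 → ℝ) : Prop :=
  ContDiff ℝ ∞ φ ∧ HasCompactSupport φ

/-- Symmetric 2-tensor fields of class `L²`. -/
def IsSymmL2 (f : TensorField) : Prop :=
  (∀ j k : Fin 3, MemLp (fun x => f x j k) 2 volume) ∧ ∀ᵐ x : E3, (f x).IsSymm

/-- `δ f = 0` in the sense of distributions, where `(δ f)_j = ∑ k, ∂_k f_{jk}`. -/
def IsSolenoidal (f : TensorField) : Prop :=
  ∀ (j : Fin 3) (φ : E3 → ℝ), IsTestFunction φ →
    ∑ k : Fin 3, ∫ x : E3, f x j k * partialDeriv k φ x = 0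

/-- `h = d v` in the sense of distributions, where `d` is the inner derivative
`(d v)_{jk} = (∂_j v_k + ∂_k v_j) / 2`. -/
def IsInnerDeriv (v : E3 → E3) (h : TensorField) : Prop :=
  ∀ (j k : Fin 3) (φ : E3 → ℝ), IsTestFunction φ →
    ∫ x : E3, h x j k * φ x =
      -((1 / 2 : ℝ) * ∫ x : E3, (v x k * partialDeriv j φ x + v x j * partialDeriv k φ x))

/-- A covector field vanishes at infinity, in the sense used for fields defined up to null sets:
each set `{|v| > ε}`, `ε > 0`, has finite volume. -/
def VanishesAtInfinity (v : E3 → E3) : Prop :=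
  ∀ ε : ℝ, 0 < ε → volume {x : E3 | ε < ‖v x‖} < ⊤

/-- `w = S(u)`, the solenoidal part of the symmetric `L²` field `u`:
`u = w + d v` with `δ w = 0` and `v` vanishing at infinity. -/
def IsSolenoidalPart (u w : TensorField) : Prop :=
  IsSymmL2 w ∧ IsSolenoidal w ∧
    ∃ v : E3 → E3, LocallyIntegrable v volume ∧ VanishesAtInfinity v ∧
      IsInnerDeriv v (fun x => u x - w x)

/-- The integrand `u_{jk}(x + t ξ) ξ^j ξ^k` of the longitudinal ray transform. -/
def rayIntegrand (u : TensorField) (x ξ : E3) (t : ℝ) : ℝ :=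
  ∑ j : Fin 3, ∑ k : Fin 3, u (x + t • ξ) j k * ξ j * ξ k

/-- The longitudinal ray transform `(I u)(x, ξ)`, the integral along the line through `x` with
direction `ξ`. -/
def rayTransform (u : TensorField) (x ξ : E3) : ℝ :=
  ∫ t : ℝ, rayIntegrand u x ξ t

/-- `I u = 0`: for almost every line, the integral converges absolutely and is equal to zero.
By homogeneity in `ξ`, it is the same to require it for unit directions `ξ` only. -/
def RayTransformVanishes (u : TensorField) : Prop :=
  ∀ᵐ p : E3 × E3, Integrable (rayIntegrand u p.1 p.2) volume ∧ rayTransform u p.1 p.2 = 0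

/-- The tensor field `f + a (tr f) g`. -/
def addTrace (a : ℝ) (f : TensorField) : TensorField :=
  fun x => f x + (a * (f x).trace) • (1 : Matrix (Fin 3) (Fin 3) ℝ)

/-- The tensor field `α g`. -/
def scalarTensor (α : E3 → ℝ) : TensorField :=
  fun x => α x • (1 : Matrix (Fin 3) (Fin 3) ℝ)

/-- The constant `a = (ν₁ + ν₂) / (2 (1 + ν₃ + ν₄))` formed from Man's parameters. -/
def manConstant (ν₁ ν₂ ν₃ ν₄ : ℝ) : ℝ :=
  (ν₁ + ν₂) / (2 * (1 + ν₃ + ν₄))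

end

/-!
Everything is decided on the Fourier side, frequency by frequency. Let `F` be the transform of the
solenoidal field `f`, so that `F(y) y = 0`, and let `P(y)` be the orthogonal projection onto the
complement of `y`.

The main tool is `rayTransformVanishes_iff`: an `L²` field `u` with transform `U` has `I u = 0` if
and only if for almost every `y` the form `U(y)` vanishes on the complement of `y`. Both directions
rest on a bound of the ray transform from `L²` to a weighted `L¹` space of lines
(`exists_bound_ray`), which also gives a meaning to `I u` on almost every line.

* If `U(y)` vanishes on the complement of `y`, then `U(ξ, ξ)` is divisible by `⟪ξ, y⟫`; after
  a truncation in frequency, the integrand of the ray transform is the derivative along the line of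
  a function which tends to zero, and the truncation is removed by means of the bound.
* If `I u = 0`, the equation is averaged over all lines `x + t ξ` with weights `𝓕 φ (x)` and
  `𝓕 g (ξ)`, where `g` is a smooth function of `‖y‖² + ⟪b, y⟫²`. Since the weight `ξ_j ξ_k 𝓕 g (ξ)`
  is the transform of a Hessian, this becomes an equation between `U(y)` and integrals of
  the Hessian of `g` along the line `t ↦ t y`, which an integration by parts evaluates
  (`integral_lineDerivOp_ellipsoidTest`). Varying `b` gives `U(w, w) = 0` for all `w ⊥ y`.

For `u = f + a (tr f) g` the criterion, together with `F(y) y = 0`, says that `F = -a (tr F) P`.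
The trace of `P` is two, so `(1 + 2a) tr F = 0`. If `a ≠ -1/2`, then `tr F = 0` and `F = 0`. If
`a = -1/2`, then `F = (tr F / 2) P`, and conversely every field with transform `A P` is in the
kernel; an example with compact support is `(Δψ) g - ∇²ψ`. The equation `a = -1/2` is
`ν₁ + ν₂ + ν₃ + ν₄ = -1`.

The field with transform `A P`, where `A` is the transform of `α`, is the solenoidal part of `α g`.
The potential `v` has transform `A y / (2πi‖y‖²)`; its low-frequency part tends to zero by the
Riemann–Lebesgue lemma and its high-frequency part is in `L²`, so that it vanishes at infinity
(`exists_potential`). For uniqueness, `v` is only locally integrable and may have no Fourier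
transform; it is eliminated from the equation `u - w = d v` by divergence-free test tensors
(`vanishesOnOrthogonal_of_isInnerDeriv`), and the remaining algebra is the same as above.
-/

namespace ElasticRay

open SchwartzMap FourierTransform Filter Topology LineDeriv
open scoped SchwartzMap ENNReal LineDeriv ComplexConjugate

/-! ### Density of compactly supported functions in the Schwartz space -/

section Density

variable {E F : Type*} [NormedAddCommGroup E] [InnerProductSpace ℝ E]
  [NormedAddCommGroup F] [NormedSpace ℝ F]

/-- Rescaled cutoffs `χ(c x)`, `|c| ≤ 1`, have derivatives bounded uniformly in `c`. -/
theorem exists_bound_iteratedFDeriv_comp_smul {χ : E → ℝ} (hχ : ContDiff ℝ ∞ χ)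
    (hc : HasCompactSupport χ) (i : ℕ) :
    ∃ C : ℝ, 0 ≤ C ∧ ∀ c : ℝ, |c| ≤ 1 → ∀ x : E,
      ‖iteratedFDeriv ℝ i (fun z => χ (c • z)) x‖ ≤ C := by
  obtain ⟨C, hC⟩ := (hc.iteratedFDeriv (𝕜 := ℝ) i).exists_bound_of_continuous
    (hχ.continuous_iteratedFDeriv (by exact_mod_cast le_top))
  refine ⟨C, (norm_nonneg _).trans (hC 0), fun c hcle x => ?_⟩
  rw [iteratedFDeriv_comp_const_smul c (hχ.of_le (by exact_mod_cast le_top)), norm_smul, norm_pow,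
    Real.norm_eq_abs]
  calc |c| ^ i * ‖iteratedFDeriv ℝ i χ (c • x)‖ ≤ 1 * C := by
        gcongr
        · exact pow_le_one₀ (abs_nonneg _) hcle
        · exact hC _
    _ = C := one_mul C

/-- The compactly supported functions are dense in the Schwartz space: on the complement of the ball
of radius `n`, where the cutoff at scale `n` differs from one, one spare power of `‖x‖` gains the
factor `1 / n` in every seminorm. -/
theorem exists_seq_hasCompactSupport_tendsto [FiniteDimensional ℝ E] (φ : 𝓢(E, F)) :
    ∃ s : ℕ → 𝓢(E, F), (∀ n, HasCompactSupport (s n)) ∧ Tendsto s atTop (𝓝 φ) := by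
  let χ : ContDiffBump (0 : E) := ⟨1, 2, one_pos, one_lt_two⟩
  have hχs : ContDiff ℝ ∞ (χ : E → ℝ) := χ.contDiff
  have hχc : HasCompactSupport (χ : E → ℝ) := χ.hasCompactSupport
  let c : ℕ → ℝ := fun n => ((n : ℝ) + 1)⁻¹
  have hcpos : ∀ n, 0 < c n := fun n => by positivity
  have hcle : ∀ n, |c n| ≤ 1 := fun n => by
    rw [abs_of_pos (hcpos n)]
    exact inv_le_one_of_one_le₀ (by linarith [(Nat.cast_nonneg n : (0 : ℝ) ≤ n)])
  let η : ℕ → E → ℝ := fun n x => χ (c n • x)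
  have hηs : ∀ n, ContDiff ℝ ∞ (η n) := fun n => hχs.comp (contDiff_const_smul (c n))
  have hηc : ∀ n, HasCompactSupport (η n) := fun n =>
    hχc.comp_homeomorph (Homeomorph.smulOfNeZero (c n) (hcpos n).ne')
  have hηg : ∀ n, (η n).HasTemperateGrowth := fun n => (hηc n).hasTemperateGrowth (hηs n)
  refine ⟨fun n => smulLeftCLM F (η n) φ, fun n => ?_, ?_⟩
  · have : (⇑(smulLeftCLM F (η n) φ) : E → F) = fun x => η n x • φ x := by
      ext x; rw [smulLeftCLM_apply_apply (hηg n)]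
    rw [this]
    exact (hηc n).smul_right
  rw [(schwartz_withSeminorms ℝ E F).tendsto_nhds]
  rintro ⟨k, l⟩ ε hε
  choose C hC0 hC using fun i => exists_bound_iteratedFDeriv_comp_smul hχs hχc i
  let M : ℝ := (∑ i ∈ Finset.range (l + 1), (l.choose i : ℝ) * C i *
    SchwartzMap.seminorm ℝ (k + 1) (l - i) φ) + SchwartzMap.seminorm ℝ (k + 1) l φ
  have hM : 0 ≤ M := by
    refine add_nonneg (Finset.sum_nonneg fun i _ => ?_) (apply_nonneg _ _)
    exact mul_nonneg (mul_nonneg (Nat.cast_nonneg _) (hC0 i)) (apply_nonneg _ _)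
  have key : ∀ n, SchwartzMap.seminorm ℝ k l (smulLeftCLM F (η n) φ - φ) ≤ c n * M := by
    intro n
    refine SchwartzMap.seminorm_le_bound ℝ k l _ (mul_nonneg (hcpos n).le hM) fun x => ?_
    have hcoe : (⇑(smulLeftCLM F (η n) φ - φ) : E → F) = (fun x => η n x • φ x) - φ := by
      ext x; simp [smulLeftCLM_apply_apply (hηg n)]
    rw [hcoe]
    by_cases hx : ‖x‖ < n + 1
    · -- near `x` the cutoff is identically one
      have hev : ((fun x => η n x • φ x) - ⇑φ) =ᶠ[𝓝 x] fun _ => (0 : F) := by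
        have : ∀ᶠ z in 𝓝 x, ‖z‖ < n + 1 := continuous_norm.continuousAt.eventually_lt_const hx
        filter_upwards [this] with z hz
        have : χ (c n • z) = 1 := by
          apply χ.one_of_mem_closedBall
          rw [mem_closedBall_zero_iff, norm_smul, Real.norm_eq_abs, abs_of_pos (hcpos n)]
          change ((n : ℝ) + 1)⁻¹ * ‖z‖ ≤ 1
          rw [inv_mul_le_iff₀ (by positivity)]
          linarith
        simp [η, this]
      rw [(hev.iteratedFDeriv ℝ l).self_of_nhds]
      have : iteratedFDeriv ℝ l (fun _ : E => (0 : F)) x = 0 := by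
        rcases l.eq_zero_or_pos with h | h
        · subst h; ext; simp
        · simp [iteratedFDeriv_const_of_ne h.ne']
      rw [this]
      simpa using mul_nonneg (hcpos n).le hM
    · push Not at hx
      have h1 : ∀ m, ‖x‖ ^ k * ‖iteratedFDeriv ℝ m φ x‖ ≤
          c n * SchwartzMap.seminorm ℝ (k + 1) m φ := by
        intro m
        have h2 := SchwartzMap.le_seminorm ℝ (k + 1) m φ x
        have h3 : 1 ≤ c n * ‖x‖ := by
          change 1 ≤ ((n : ℝ) + 1)⁻¹ * ‖x‖
          rw [inv_mul_eq_div, le_div_iff₀ (by positivity)]; linarith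
        calc ‖x‖ ^ k * ‖iteratedFDeriv ℝ m φ x‖
            ≤ (c n * ‖x‖) * (‖x‖ ^ k * ‖iteratedFDeriv ℝ m φ x‖) :=
              le_mul_of_one_le_left (by positivity) h3
          _ = c n * (‖x‖ ^ (k + 1) * ‖iteratedFDeriv ℝ m φ x‖) := by ring
          _ ≤ _ := by gcongr
      have h4 : ‖iteratedFDeriv ℝ l ((fun x => η n x • φ x) - ⇑φ) x‖ ≤
          (∑ i ∈ Finset.range (l + 1), (l.choose i : ℝ) * C i *
            ‖iteratedFDeriv ℝ (l - i) φ x‖) + ‖iteratedFDeriv ℝ l φ x‖ := by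
        have hsm : ContDiffAt ℝ l (fun x => η n x • φ x) x :=
          (((hηs n).of_le (by exact_mod_cast le_top)).smul (φ.smooth l)).contDiffAt
        rw [iteratedFDeriv_sub_apply hsm (φ.smooth l).contDiffAt]
        refine (norm_sub_le _ _).trans (add_le_add_left ?_ _)
        refine (norm_iteratedFDeriv_smul_le (N := ∞) (hηs n) (φ.smooth ⊤) x
          (by exact_mod_cast le_top)).trans (Finset.sum_le_sum fun i _ => ?_)
        gcongr
        exact hC i (c n) (hcle n) x
      calc ‖x‖ ^ k * ‖iteratedFDeriv ℝ l ((fun x => η n x • φ x) - ⇑φ) x‖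
          ≤ ‖x‖ ^ k * ((∑ i ∈ Finset.range (l + 1), (l.choose i : ℝ) * C i *
            ‖iteratedFDeriv ℝ (l - i) φ x‖) + ‖iteratedFDeriv ℝ l φ x‖) := by gcongr
        _ = (∑ i ∈ Finset.range (l + 1), (l.choose i : ℝ) * C i *
            (‖x‖ ^ k * ‖iteratedFDeriv ℝ (l - i) φ x‖)) +
              ‖x‖ ^ k * ‖iteratedFDeriv ℝ l φ x‖ := by
            rw [mul_add, Finset.mul_sum]
            congr 1
            exact Finset.sum_congr rfl fun i _ => by ring
        _ ≤ (∑ i ∈ Finset.range (l + 1), (l.choose i : ℝ) * C i *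
            (c n * SchwartzMap.seminorm ℝ (k + 1) (l - i) φ)) +
              c n * SchwartzMap.seminorm ℝ (k + 1) l φ := by
            refine add_le_add (Finset.sum_le_sum fun i _ => ?_) (h1 l)
            exact mul_le_mul_of_nonneg_left (h1 _) (mul_nonneg (Nat.cast_nonneg _) (hC0 i))
        _ = c n * M := by
            simp only [M]
            rw [mul_add, Finset.mul_sum]
            congr 1
            exact Finset.sum_congr rfl fun i _ => by ring
  have hlim : Tendsto (fun n => c n * M) atTop (𝓝 0) := by
    have : Tendsto c atTop (𝓝 0) := by
      simpa [c, one_div] using (tendsto_one_div_add_atTop_nhds_zero_nat (𝕜 := ℝ))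
    simpa using this.mul_const M
  filter_upwards [hlim.eventually_lt_const hε] with n hn
  exact (key n).trans_lt hn

end Density

/-- A continuous linear functional on the complex Schwartz functions vanishes as soon as it vanishes
on real-valued test functions. -/
theorem eq_zero_of_real_test {E : Type*} [NormedAddCommGroup E] [InnerProductSpace ℝ E]
    [FiniteDimensional ℝ E] (Λ : 𝓢(E, ℂ) →L[ℂ] ℂ)
    (h : ∀ (g : E → ℝ), ContDiff ℝ ∞ g → HasCompactSupport g → ∀ (φ : 𝓢(E, ℂ)),
      (∀ x, φ x = (g x : ℂ)) → Λ φ = 0) : Λ = 0 := by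
  have hcomp : ∀ φ : 𝓢(E, ℂ), HasCompactSupport φ → Λ φ = 0 := by
    intro φ hφ
    have hre : HasCompactSupport (fun x => (φ x).re) := hφ.comp_left (g := Complex.re) rfl
    have him : HasCompactSupport (fun x => (φ x).im) := hφ.comp_left (g := Complex.im) rfl
    have sre : ContDiff ℝ ∞ (fun x => (φ x).re) :=
      Complex.reCLM.contDiff.comp (φ.smooth ⊤)
    have sim : ContDiff ℝ ∞ (fun x => (φ x).im) :=
      Complex.imCLM.contDiff.comp (φ.smooth ⊤)
    have c1 : HasCompactSupport (fun x => ((φ x).re : ℂ)) :=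
      hre.comp_left (g := ((↑) : ℝ → ℂ)) rfl
    have c2 : HasCompactSupport (fun x => ((φ x).im : ℂ)) :=
      him.comp_left (g := ((↑) : ℝ → ℂ)) rfl
    let a : 𝓢(E, ℂ) := c1.toSchwartzMap (Complex.ofRealCLM.contDiff.comp sre)
    let b : 𝓢(E, ℂ) := c2.toSchwartzMap (Complex.ofRealCLM.contDiff.comp sim)
    have hab : φ = a + Complex.I • b := by
      ext x
      change φ x = ((φ x).re : ℂ) + Complex.I * ((φ x).im : ℂ)
      rw [mul_comm]; exact (Complex.re_add_im _).symm
    rw [hab, map_add, map_smul, h _ sre hre a (fun _ => rfl), h _ sim him b (fun _ => rfl)]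
    simp
  ext φ
  obtain ⟨s, hs, hlim⟩ := exists_seq_hasCompactSupport_tendsto φ
  have h1 := (Λ.continuous.tendsto φ).comp hlim
  have h2 : (Λ ∘ s) = fun _ => 0 := funext fun n => hcomp _ (hs n)
  rw [h2] at h1
  exact tendsto_nhds_unique h1 tendsto_const_nhds

/-! ### The Fourier transform of square-integrable functions -/

section FourierPair

variable {E : Type*} [NormedAddCommGroup E] [InnerProductSpace ℝ E] [FiniteDimensional ℝ E]
  [MeasurableSpace E] [BorelSpace E]

/-- `U` is the Fourier transform of the `L²` function `u`. The transform is characterized by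
duality with Schwartz functions, which frees statements from the choice of representatives. -/
structure IsFourierPair (u U : E → ℂ) : Prop where
  memLp_left : MemLp u 2 volume
  memLp_right : MemLp U 2 volume
  pairing : ∀ θ : 𝓢(E, ℂ), ∫ y, θ y * U y = ∫ x, 𝓕 θ x * u x

theorem Lp_pairing (v : Lp ℂ 2 (volume : Measure E)) (θ : 𝓢(E, ℂ)) :
    ∫ y, θ y * (𝓕 v : Lp ℂ 2 (volume : Measure E)) y = ∫ x, 𝓕 θ x * v x := by
  have := congrArg (fun T : 𝓢'(E, ℂ) => T θ) (Lp.fourier_toTemperedDistribution_eq v)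
  simp only [TemperedDistribution.fourier_apply, Lp.toTemperedDistribution_apply, smul_eq_mul]
    at this
  exact this.symm

theorem IsFourierPair.of_Lp (v : Lp ℂ 2 (volume : Measure E)) :
    IsFourierPair v (𝓕 v : Lp ℂ 2 (volume : Measure E)) :=
  ⟨Lp.memLp _, Lp.memLp _, Lp_pairing v⟩

theorem IsFourierPair.congr {u u' U U' : E → ℂ} (h : IsFourierPair u U) (hu : u =ᵐ[volume] u')
    (hU : U =ᵐ[volume] U') : IsFourierPair u' U' := by
  refine ⟨h.1.ae_eq hu, h.2.ae_eq hU, fun θ => ?_⟩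
  have h1 : ∫ y, θ y * U y = ∫ y, θ y * U' y :=
    integral_congr_ae (by filter_upwards [hU] with y hy; rw [hy])
  have h2 : ∫ y, 𝓕 θ y * u y = ∫ y, 𝓕 θ y * u' y :=
    integral_congr_ae (by filter_upwards [hu] with y hy; rw [hy])
  rw [← h1, ← h2, h.3 θ]

theorem exists_isFourierPair {u : E → ℂ} (hu : MemLp u 2 volume) : ∃ U, IsFourierPair u U :=
  ⟨_, (IsFourierPair.of_Lp (hu.toLp u)).congr hu.coeFn_toLp EventuallyEq.rfl⟩

theorem exists_isFourierPair_inv {U : E → ℂ} (hU : MemLp U 2 volume) :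
    ∃ u, IsFourierPair u U := by
  refine ⟨(𝓕⁻ (hU.toLp U) : Lp ℂ 2 (volume : Measure E)), ?_⟩
  have := IsFourierPair.of_Lp (𝓕⁻ (hU.toLp U) : Lp ℂ 2 (volume : Measure E))
  rw [fourier_fourierInv_eq] at this
  exact this.congr EventuallyEq.rfl hU.coeFn_toLp

/-- The fundamental lemma of the calculus of variations, for Schwartz test functions. -/
theorem ae_eq_zero_of_schwartz {U : E → ℂ} (hU : LocallyIntegrable U volume)
    (h : ∀ θ : 𝓢(E, ℂ), ∫ y, θ y * U y = 0) : U =ᵐ[volume] 0 := by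
  refine ae_eq_zero_of_integral_contDiff_smul_eq_zero hU fun g hg hc => ?_
  have c1 : HasCompactSupport (fun x => (g x : ℂ)) := hc.comp_left (g := ((↑) : ℝ → ℂ)) rfl
  exact h (c1.toSchwartzMap (Complex.ofRealCLM.contDiff.comp hg))

theorem integrable_schwartz_mul (θ : 𝓢(E, ℂ)) {u : E → ℂ} (hu : MemLp u 2 volume) :
    Integrable (fun x => θ x * u x) volume :=
  (θ.memLp 2).integrable_mul hu

theorem ae_eq_of_schwartz {U V : E → ℂ} (hU : MemLp U 2 volume) (hV : MemLp V 2 volume)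
    (h : ∀ θ : 𝓢(E, ℂ), ∫ y, θ y * U y = ∫ y, θ y * V y) : U =ᵐ[volume] V := by
  have := ae_eq_zero_of_schwartz (U := fun y => U y - V y)
    ((hU.sub hV).locallyIntegrable one_le_two) (fun θ => by
      simp_rw [mul_sub]
      rw [integral_sub (integrable_schwartz_mul θ hU) (integrable_schwartz_mul θ hV), h,
        sub_self])
  filter_upwards [this] with y hy
  exact sub_eq_zero.mp hy

theorem IsFourierPair.unique_right {u U U' : E → ℂ} (h : IsFourierPair u U)
    (h' : IsFourierPair u U') : U =ᵐ[volume] U' :=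
  ae_eq_of_schwartz h.2 h'.2 fun θ => (h.3 θ).trans (h'.3 θ).symm

theorem IsFourierPair.pairing_inv {u U : E → ℂ} (h : IsFourierPair u U) (φ : 𝓢(E, ℂ)) :
    ∫ x, φ x * u x = ∫ y, 𝓕⁻ φ y * U y := by
  rw [h.3, fourier_fourierInv_eq]

theorem IsFourierPair.unique_left {u u' U : E → ℂ} (h : IsFourierPair u U)
    (h' : IsFourierPair u' U) : u =ᵐ[volume] u' :=
  ae_eq_of_schwartz h.1 h'.1 fun θ => (h.pairing_inv θ).trans (h'.pairing_inv θ).symm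

theorem IsFourierPair.add {u v U V : E → ℂ} (h : IsFourierPair u U) (h' : IsFourierPair v V) :
    IsFourierPair (fun x => u x + v x) (fun y => U y + V y) := by
  refine ⟨h.1.add h'.1, h.2.add h'.2, fun θ => ?_⟩
  simp_rw [mul_add]
  rw [integral_add (integrable_schwartz_mul θ h.2) (integrable_schwartz_mul θ h'.2),
    integral_add (integrable_schwartz_mul (𝓕 θ) h.1) (integrable_schwartz_mul (𝓕 θ) h'.1),
    h.3, h'.3]

theorem IsFourierPair.const_mul {u U : E → ℂ} (h : IsFourierPair u U) (c : ℂ) :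
    IsFourierPair (fun x => c * u x) (fun y => c * U y) := by
  refine ⟨h.1.const_mul c, h.2.const_mul c, fun θ => ?_⟩
  simp_rw [mul_left_comm _ c]
  rw [integral_const_mul, integral_const_mul, h.3]

theorem IsFourierPair.zero : IsFourierPair (fun _ : E => (0 : ℂ)) (fun _ => 0) :=
  ⟨MemLp.zero', MemLp.zero', fun θ => by simp⟩

theorem IsFourierPair.sub {u v U V : E → ℂ} (h : IsFourierPair u U) (h' : IsFourierPair v V) :
    IsFourierPair (fun x => u x - v x) (fun y => U y - V y) := by
  simpa [sub_eq_add_neg] using h.add (h'.const_mul (-1))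

theorem IsFourierPair.sum {ι : Type*} (s : Finset ι) {u U : ι → E → ℂ}
    (h : ∀ i ∈ s, IsFourierPair (u i) (U i)) :
    IsFourierPair (fun x => ∑ i ∈ s, u i x) (fun y => ∑ i ∈ s, U i y) := by
  classical
  induction s using Finset.induction_on with
  | empty => simpa using IsFourierPair.zero
  | insert a s ha ih =>
    simp_rw [Finset.sum_insert ha]
    exact (h a (Finset.mem_insert_self _ _)).add
      (ih fun i hi => h i (Finset.mem_insert_of_mem hi))

/-- Plancherel's theorem. -/
theorem IsFourierPair.eLpNorm_eq {u U : E → ℂ} (h : IsFourierPair u U) :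
    eLpNorm u 2 volume = eLpNorm U 2 volume := by
  have h1 := (IsFourierPair.of_Lp (h.1.toLp u)).congr h.1.coeFn_toLp EventuallyEq.rfl
  have h2 := h.unique_right h1
  rw [eLpNorm_congr_ae h2]
  have h3 := Lp.norm_fourier_eq (h.1.toLp u)
  rw [Lp.norm_def, Lp.norm_def, ENNReal.toReal_eq_toReal_iff' (Lp.eLpNorm_ne_top _)
    (Lp.eLpNorm_ne_top _)] at h3
  rw [h3, eLpNorm_congr_ae h.1.coeFn_toLp]

/-- The inverse Fourier integral of an integrable function is its inverse transform in the sense of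
duality. -/
theorem integral_fourier_mul_fourierInv {m : E → ℂ} (hm : Integrable m volume) (θ : 𝓢(E, ℂ)) :
    ∫ x, 𝓕 θ x * 𝓕⁻ m x = ∫ y, θ y * m y := by
  have key : ∀ φ : 𝓢(E, ℂ), ∫ x, φ x * 𝓕⁻ m x = ∫ y, 𝓕⁻ φ y * m y := by
    intro φ
    have := VectorFourier.integral_fourierIntegral_smul_eq_flip (𝕜 := ℝ) (e := Real.fourierChar)
      (μ := volume) (ν := volume) (L := -(innerₗ E)) (f := φ) (g := m) Real.continuous_fourierChar
      (continuous_fst.inner continuous_snd).neg φ.integrable hm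
    simp only [smul_eq_mul] at this
    have h1 : ∀ x, VectorFourier.fourierIntegral Real.fourierChar volume (-(innerₗ E)) φ x =
        𝓕⁻ φ x := fun x => by rw [SchwartzMap.fourierInv_coe]; rfl
    have h2 : ∀ x, VectorFourier.fourierIntegral Real.fourierChar volume (-(innerₗ E)).flip m x =
        𝓕⁻ m x := fun x => by
      rw [Real.fourierInv_eq]
      simp [VectorFourier.fourierIntegral, real_inner_comm]
    simp_rw [h1, h2] at this
    exact this.symm
  rw [key, fourierInv_fourier_eq]

theorem continuous_fourierInv {m : E → ℂ} (hm : Integrable m volume) : Continuous (𝓕⁻ m) := by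
  have := VectorFourier.fourierIntegral_continuous (𝕜 := ℝ) (e := Real.fourierChar)
    (L := -(innerₗ E)) Real.continuous_fourierChar (continuous_fst.inner continuous_snd).neg hm
  exact this

/-- The Riemann–Lebesgue lemma. -/
theorem tendsto_fourierInv_cocompact (m : E → ℂ) : Tendsto (𝓕⁻ m) (cocompact E) (𝓝 0) := by
  have h := (tendsto_integral_exp_inner_smul_cocompact m).comp
    (Homeomorph.neg E).isClosedEmbedding.tendsto_cocompact
  refine h.congr fun w => ?_
  rw [Real.fourierInv_eq]
  simp

theorem isFourierPair_fourierInv {m : E → ℂ} (hm : Integrable m volume)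
    (hm2 : MemLp m 2 volume) : IsFourierPair (𝓕⁻ m) m := by
  obtain ⟨u, hu⟩ := exists_isFourierPair_inv hm2
  refine hu.congr ?_ EventuallyEq.rfl
  have hloc : LocallyIntegrable (fun x => u x - 𝓕⁻ m x) volume :=
    (hu.1.locallyIntegrable one_le_two).sub (continuous_fourierInv hm).locallyIntegrable
  obtain ⟨C, hC⟩ : ∃ C, ∀ x, ‖𝓕⁻ m x‖ ≤ C :=
    ⟨∫ v, ‖m v‖, fun x => VectorFourier.norm_fourierIntegral_le_integral_norm _ _ _ _ _⟩
  have := ae_eq_zero_of_schwartz hloc fun θ => by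
    have h1 : Integrable (fun x => θ x * 𝓕⁻ m x) volume :=
      θ.integrable.mul_bdd (c := C) (continuous_fourierInv hm).aestronglyMeasurable
        (Eventually.of_forall hC)
    simp_rw [mul_sub]
    rw [integral_sub (integrable_schwartz_mul θ hu.1) h1, hu.pairing_inv]
    have h2 := integral_fourier_mul_fourierInv hm (𝓕⁻ θ)
    rw [fourier_fourierInv_eq] at h2
    rw [h2, sub_self]
  filter_upwards [this] with x hx
  exact sub_eq_zero.mp hx

/-- The Fourier transform of `conj u` is `y ↦ conj (U (-y))`. -/
theorem IsFourierPair.conj {u U : E → ℂ} (h : IsFourierPair u U) :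
    IsFourierPair (fun x => conj (u x)) (fun y => conj (U (-y))) := by
  have hneg : MeasurePreserving (fun y : E => -y) volume volume :=
    Measure.measurePreserving_neg volume
  refine ⟨h.1.star, (h.2.comp_measurePreserving hneg).star, fun θ => ?_⟩
  let θ' : 𝓢(E, ℂ) := SchwartzMap.postcompCLM (𝕜 := ℝ) (Complex.conjCLE : ℂ →L[ℝ] ℂ)
    (compCLMOfContinuousLinearEquiv ℝ (ContinuousLinearEquiv.neg ℝ) θ)
  have hθ' : ∀ y, θ' y = conj (θ (-y)) := fun y => rfl
  have hF : ∀ x, 𝓕 θ' x = conj (𝓕 θ x) := by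
    intro x
    rw [SchwartzMap.fourier_coe, SchwartzMap.fourier_coe, Real.fourier_eq, Real.fourier_eq,
      ← integral_conj, ← integral_neg_eq_self]
    refine integral_congr_ae (Eventually.of_forall fun y => ?_)
    simp only [hθ', neg_neg, inner_neg_left, Circle.smul_def, smul_eq_mul, map_mul,
      ← Circle.coe_inv_eq_conj, ← AddChar.map_neg_eq_inv]
  have h3 := congrArg conj (h.3 θ')
  rw [← integral_conj, ← integral_conj, ← integral_neg_eq_self] at h3
  simpa [hθ', hF] using h3

end FourierPair

/-! ### An integral bound for the ray transform -/

/-- The `L²` norm of a function with values in `[0, ∞]`. -/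
noncomputable def l2 (N : E3 → ℝ≥0∞) : ℝ≥0∞ := (∫⁻ x, N x ^ (2 : ℝ)) ^ (1 / 2 : ℝ)

theorem lintegral_mul_le_l2 {f g : E3 → ℝ≥0∞} (hf : Measurable f) (hg : Measurable g) :
    ∫⁻ x, f x * g x ≤ l2 f * l2 g :=
  ENNReal.lintegral_mul_le_Lp_mul_Lq volume Real.HolderConjugate.two_two hf.aemeasurable
    hg.aemeasurable

theorem l2_enorm {F : Type*} [NormedAddCommGroup F] (u : E3 → F) :
    l2 (fun x => ‖u x‖ₑ) = eLpNorm u 2 volume := by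
  rw [eLpNorm_eq_lintegral_rpow_enorm_toReal (by norm_num) (by norm_num), l2]
  simp

theorem l2_comp_add_right (N : E3 → ℝ≥0∞) (h : E3) : l2 (fun x => N (x + h)) = l2 N := by
  rw [l2, l2, lintegral_add_right_eq_self (fun x => N x ^ (2 : ℝ)) h]

theorem lintegral_comp_smul {N : E3 → ℝ≥0∞} (hN : Measurable N) {t : ℝ} (ht : t ≠ 0) :
    ∫⁻ ξ, N (t • ξ) = ENNReal.ofReal (|t| ^ (-3 : ℝ)) * ∫⁻ ξ, N ξ := by
  have h := Measure.map_addHaar_smul (volume : Measure E3) ht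
  rw [← lintegral_map hN (measurable_const_smul t), h, lintegral_smul_measure, smul_eq_mul]
  congr 2
  rw [finrank_euclideanSpace_fin, abs_inv, abs_pow, Real.rpow_neg (abs_nonneg _)]
  norm_cast

theorem l2_comp_add_smul {N : E3 → ℝ≥0∞} (hN : Measurable N) (x : E3) {t : ℝ} (ht : t ≠ 0) :
    l2 (fun ξ => N (x + t • ξ)) = ENNReal.ofReal (|t| ^ (-(3 / 2) : ℝ)) * l2 N := by
  have h := lintegral_comp_smul (N := fun z => N (x + z) ^ (2 : ℝ))
    ((hN.comp (measurable_const_add x)).pow_const _) ht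
  rw [l2, h, lintegral_add_left_eq_self (fun z => N z ^ (2 : ℝ)) x,
    ENNReal.mul_rpow_of_nonneg _ _ (by norm_num),
    ENNReal.ofReal_rpow_of_nonneg (by positivity) (by norm_num), ← Real.rpow_mul (abs_nonneg _), l2]
  norm_num

/-- A function of time that is bounded and decays like `|t|^{-3/2}` is integrable. -/
theorem exists_bound_lintegral_of_decay : ∃ K : ℝ≥0∞, K ≠ ⊤ ∧ ∀ (J : ℝ → ℝ≥0∞) (A : ℝ≥0∞),
    (∀ t, J t ≤ A) → (∀ t, t ≠ 0 → J t ≤ ENNReal.ofReal (|t| ^ (-(3 / 2) : ℝ)) * A) →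
    ∫⁻ t, J t ≤ K * A := by
  have hfin : (∫⁻ t : ℝ, ENNReal.ofReal ((1 + ‖t‖) ^ (-(3 / 2) : ℝ))) < ⊤ :=
    finite_integral_one_add_norm (by norm_num)
  refine ⟨ENNReal.ofReal (2 ^ (3 / 2 : ℝ)) * ∫⁻ t : ℝ, ENNReal.ofReal ((1 + ‖t‖) ^ (-(3 / 2) : ℝ)),
    ENNReal.mul_ne_top ENNReal.ofReal_ne_top hfin.ne, fun J A h1 h2 => ?_⟩
  have hb : ∀ t, J t ≤ ENNReal.ofReal (2 ^ (3 / 2 : ℝ)) *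
      ENNReal.ofReal ((1 + ‖t‖) ^ (-(3 / 2) : ℝ)) * A := by
    intro t
    have hpos : (0 : ℝ) < 1 + ‖t‖ := by positivity
    have e : (2 : ℝ) ^ (3 / 2 : ℝ) * (1 + ‖t‖) ^ (-(3 / 2) : ℝ) =
        ((1 + ‖t‖) / 2) ^ (-(3 / 2) : ℝ) := by
      rw [Real.div_rpow hpos.le (by norm_num), Real.rpow_neg (by norm_num : (0 : ℝ) ≤ 2),
        div_inv_eq_mul, mul_comm]
    rw [← ENNReal.ofReal_mul (by positivity), e]
    by_cases ht : |t| ≤ 1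
    · refine (h1 t).trans (le_mul_of_one_le_left zero_le ?_)
      rw [← ENNReal.ofReal_one]
      refine ENNReal.ofReal_le_ofReal (Real.one_le_rpow_of_pos_of_le_one_of_nonpos (by positivity)
        ?_ (by norm_num))
      rw [Real.norm_eq_abs]; linarith
    · push Not at ht
      have ht0 : t ≠ 0 := by rintro rfl; simp at ht; linarith
      refine (h2 t ht0).trans ?_
      gcongr ?_ * A
      refine ENNReal.ofReal_le_ofReal (Real.rpow_le_rpow_of_nonpos (by positivity) ?_
        (by norm_num))
      rw [Real.norm_eq_abs]; linarith
  calc ∫⁻ t, J t ≤ ∫⁻ t : ℝ, ENNReal.ofReal (2 ^ (3 / 2 : ℝ)) *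
      ENNReal.ofReal ((1 + ‖t‖) ^ (-(3 / 2) : ℝ)) * A := lintegral_mono hb
    _ = _ := by
      have hm : Measurable fun t : ℝ => ENNReal.ofReal ((1 + ‖t‖) ^ (-(3 / 2) : ℝ)) := by fun_prop
      rw [lintegral_mul_const _ (hm.const_mul _), lintegral_const_mul _ hm]

/-- The ray transform is bounded from `L²` to a weighted `L¹` space of lines. For `|t| ≤ 1` the
Cauchy–Schwarz inequality is used in the base point, for `|t| ≥ 1` in the direction, where the
substitution `ξ ↦ t ξ` produces the integrable factor `|t|^{-3/2}`. -/
theorem exists_bound_ray {w₁ w₂ : E3 → ℝ≥0∞} (h₁ : Measurable w₁) (h₂ : Measurable w₂)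
    (hw₁ : ∫⁻ x, w₁ x ≠ ⊤) (hw₂ : ∫⁻ x, w₂ x ≠ ⊤) (hl₁ : l2 w₁ ≠ ⊤) (hl₂ : l2 w₂ ≠ ⊤) :
    ∃ C : ℝ≥0∞, C ≠ ⊤ ∧ ∀ N : E3 → ℝ≥0∞, Measurable N →
      ∫⁻ t : ℝ, ∫⁻ x, ∫⁻ ξ, w₁ x * w₂ ξ * N (x + t • ξ) ≤ C * l2 N := by
  obtain ⟨K, hK, hKb⟩ := exists_bound_lintegral_of_decay
  refine ⟨K * ((∫⁻ x, w₂ x) * l2 w₁ + (∫⁻ x, w₁ x) * l2 w₂),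
    ENNReal.mul_ne_top hK (ENNReal.add_ne_top.2 ⟨ENNReal.mul_ne_top hw₂ hl₁,
      ENNReal.mul_ne_top hw₁ hl₂⟩), fun N hN => ?_⟩
  rw [mul_assoc]
  refine hKb _ _ (fun t => ?_) (fun t ht => ?_)
  · have hm : Measurable fun p : E3 × E3 => w₁ p.1 * w₂ p.2 * N (p.1 + t • p.2) := by fun_prop
    rw [lintegral_lintegral_swap hm.aemeasurable]
    calc ∫⁻ ξ, ∫⁻ x, w₁ x * w₂ ξ * N (x + t • ξ)
        = ∫⁻ ξ, w₂ ξ * ∫⁻ x, w₁ x * N (x + t • ξ) := by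
          refine lintegral_congr fun ξ => ?_
          rw [← lintegral_const_mul _ (by fun_prop)]
          exact lintegral_congr fun x => by ring
      _ ≤ ∫⁻ ξ, w₂ ξ * (l2 w₁ * l2 N) := by
          refine lintegral_mono fun ξ => mul_le_mul_right ?_ _
          refine (lintegral_mul_le_l2 h₁ (by fun_prop)).trans_eq ?_
          rw [l2_comp_add_right]
      _ = (∫⁻ ξ, w₂ ξ) * l2 w₁ * l2 N := by rw [lintegral_mul_const _ h₂, mul_assoc]
      _ ≤ _ := by gcongr; exact le_self_add
  · calc ∫⁻ x, ∫⁻ ξ, w₁ x * w₂ ξ * N (x + t • ξ)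
        = ∫⁻ x, w₁ x * ∫⁻ ξ, w₂ ξ * N (x + t • ξ) := by
          refine lintegral_congr fun x => ?_
          rw [← lintegral_const_mul _ (by fun_prop)]
          exact lintegral_congr fun ξ => by ring
      _ ≤ ∫⁻ x, w₁ x * (l2 w₂ * (ENNReal.ofReal (|t| ^ (-(3 / 2) : ℝ)) * l2 N)) := by
          refine lintegral_mono fun x => mul_le_mul_right ?_ _
          refine (lintegral_mul_le_l2 h₂ (by fun_prop)).trans_eq ?_
          rw [l2_comp_add_smul hN x ht]
      _ = ENNReal.ofReal (|t| ^ (-(3 / 2) : ℝ)) * ((∫⁻ x, w₁ x) * l2 w₂ * l2 N) := by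
          rw [lintegral_mul_const _ h₁]; ring
      _ ≤ _ := by gcongr; exact le_add_self

/-- A bilinear integral over the rays through the origin, controlled as in `exists_bound_ray`. -/
theorem lintegral_ray_origin_ne_top {P N G : E3 → ℝ≥0∞} (hP : Measurable P) (hN : Measurable N)
    (hG : Measurable G) {a b : ℝ≥0∞} (ha : a ≠ ⊤) (hb : b ≠ ⊤) (hPa : ∀ x, P x ≤ a)
    (hGb : ∀ x, G x ≤ b) (hP2 : l2 P ≠ ⊤) (hN2 : l2 N ≠ ⊤) (hG2 : l2 G ≠ ⊤) :
    ∫⁻ t : ℝ, ∫⁻ y, P y * N y * G (t • y) ≠ ⊤ := by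
  obtain ⟨K, hK, hKb⟩ := exists_bound_lintegral_of_decay
  have hfin : K * (l2 P * l2 N * b + a * l2 N * l2 G) ≠ ⊤ :=
    ENNReal.mul_ne_top hK (ENNReal.add_ne_top.2 ⟨ENNReal.mul_ne_top (ENNReal.mul_ne_top hP2 hN2) hb,
      ENNReal.mul_ne_top (ENNReal.mul_ne_top ha hN2) hG2⟩)
  refine ne_top_of_le_ne_top hfin (hKb _ _ (fun t => ?_) fun t ht => ?_)
  · calc ∫⁻ y, P y * N y * G (t • y) ≤ ∫⁻ y, P y * N y * b := by
          refine lintegral_mono fun y => ?_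
          gcongr
          exact hGb _
      _ ≤ l2 P * l2 N * b := by
          rw [lintegral_mul_const (f := fun y => P y * N y) b (hP.mul hN)]
          gcongr
          exact lintegral_mul_le_l2 hP hN
      _ ≤ _ := le_self_add
  · calc ∫⁻ y, P y * N y * G (t • y) ≤ ∫⁻ y, a * (N y * G (t • y)) := by
          refine lintegral_mono fun y => ?_
          rw [mul_assoc]
          gcongr
          exact hPa _
      _ ≤ a * (l2 N * (ENNReal.ofReal (|t| ^ (-(3 / 2) : ℝ)) * l2 G)) := by
          rw [lintegral_const_mul _ (by fun_prop)]
          gcongr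
          refine (lintegral_mul_le_l2 hN (by fun_prop)).trans_eq ?_
          have := l2_comp_add_smul hG 0 ht
          simp only [zero_add] at this
          rw [this]
      _ = ENNReal.ofReal (|t| ^ (-(3 / 2) : ℝ)) * (a * l2 N * l2 G) := by ring
      _ ≤ _ := by gcongr; exact le_add_self

/-! ### Differential conditions on the Fourier side -/

theorem lineDerivOp_comm {E F : Type*} [NormedAddCommGroup E]
    [InnerProductSpace ℝ E] [NormedAddCommGroup F] [NormedSpace ℝ F] (f : 𝓢(E, F))
    (p q : E) : ∂_{p} (∂_{q} f) = ∂_{q} (∂_{p} f) := by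
  ext x
  have h2 : ∀ p q : E, ∂_{p} (∂_{q} f) x = fderiv ℝ (fderiv ℝ f) x p q := by
    intro p q
    rw [lineDerivOp_apply_eq_fderiv]
    have : (⇑(∂_{q} f : 𝓢(E, F)) : E → F) = fun x => fderiv ℝ f x q := by
      ext x; rw [lineDerivOp_apply_eq_fderiv]
    rw [this]
    have hd : DifferentiableAt ℝ (fderiv ℝ f) x :=
      ((f.smooth 2).fderiv_right (m := 1) le_rfl).differentiable one_ne_zero x
    rw [fderiv_clm_apply hd (differentiableAt_const q)]
    simp
  rw [h2, h2]
  exact ((f.smooth 2).contDiffAt.isSymmSndFDerivAt (by simp)).eq p q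

section Pairing

variable {E : Type*} [NormedAddCommGroup E] [InnerProductSpace ℝ E] [FiniteDimensional ℝ E]
  [MeasurableSpace E] [BorelSpace E]

/-- Integration against an `L²` function, as a continuous functional on Schwartz functions. -/
theorem exists_pairingCLM {u : E → ℂ} (hu : MemLp u 2 volume) :
    ∃ Λ : 𝓢(E, ℂ) →L[ℂ] ℂ, ∀ φ : 𝓢(E, ℂ), Λ φ = ∫ x, φ x * u x := by
  refine ⟨(ContinuousLinearMap.mul ℂ ℂ).lpPairing volume 2 2 (hu.toLp u) ∘L
    toLpCLM ℂ ℂ 2 volume, fun φ => ?_⟩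
  rw [ContinuousLinearMap.comp_apply, ContinuousLinearMap.lpPairing_eq_integral]
  refine integral_congr_ae ?_
  filter_upwards [hu.coeFn_toLp, φ.coeFn_toLp 2 volume] with x h1 h2
  simp [h1, h2, mul_comm]

/-- A linear differential equation which holds weakly for `L²` functions tested with real test
functions holds for complex Schwartz functions. -/
theorem sum_pairing_eq_zero_of_real_test {ι : Type*} [Fintype ι] {u : ι → E → ℂ}
    (hu : ∀ i, MemLp (u i) 2 volume) (L : ι → 𝓢(E, ℂ) →L[ℂ] 𝓢(E, ℂ))
    (h : ∀ (g : E → ℝ), ContDiff ℝ ∞ g → HasCompactSupport g → ∀ φ : 𝓢(E, ℂ),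
      (∀ x, φ x = (g x : ℂ)) → ∑ i, ∫ x, L i φ x * u i x = 0) (φ : 𝓢(E, ℂ)) :
    ∑ i, ∫ x, L i φ x * u i x = 0 := by
  choose Λ hΛ using fun i => exists_pairingCLM (hu i)
  have := eq_zero_of_real_test (∑ i, Λ i ∘L L i) fun g hg hc φ hφ => by
    simpa [hΛ] using h g hg hc φ hφ
  simpa [hΛ] using congrArg (fun T : 𝓢(E, ℂ) →L[ℂ] ℂ => T φ) this

theorem lineDerivOp_fourier_apply (θ : 𝓢(E, ℂ)) (m : E) :
    ∃ θ' : 𝓢(E, ℂ), (∀ y, θ' y = -(2 * Real.pi * Complex.I) * (inner ℝ y m : ℝ) * θ y) ∧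
      ∂_{m} (𝓕 θ) = 𝓕 θ' := by
  have : (inner ℝ · m).HasTemperateGrowth := by fun_prop
  refine ⟨_, fun y => ?_, lineDerivOp_fourier_eq θ m⟩
  simp [smulLeftCLM_apply_apply this, mul_assoc]

theorem fourierInv_lineDerivOp_apply (φ : 𝓢(E, ℂ)) (m y : E) :
    𝓕⁻ (∂_{m} φ) y = -(2 * Real.pi * Complex.I) * (inner ℝ y m : ℝ) * 𝓕⁻ φ y := by
  have : (inner ℝ · m).HasTemperateGrowth := by fun_prop
  rw [fourierInv_lineDerivOp_eq]
  simp [smulLeftCLM_apply_apply this, mul_assoc]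

/-- A null set depending on a parameter can be chosen independent of it, if the dependence is
continuous. -/
theorem ae_forall_eq_zero_of_continuous {X Ω : Type*} [TopologicalSpace X]
    [TopologicalSpace.SeparableSpace X] [MeasurableSpace Ω] {μ : Measure Ω} {G : Ω → X → ℂ}
    (hG : ∀ y, Continuous (G y)) (h : ∀ x, ∀ᵐ y ∂μ, G y x = 0) : ∀ᵐ y ∂μ, ∀ x, G y x = 0 := by
  rcases isEmpty_or_nonempty X with hX | hX
  · exact Eventually.of_forall fun y x => hX.elim x
  have := ae_all_iff.2 fun n => h (TopologicalSpace.denseSeq X n)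
  filter_upwards [this] with y hy x
  have := (hG y).ext_on (TopologicalSpace.denseRange_denseSeq X) (continuous_const (y := (0 : ℂ)))
    (by rintro _ ⟨n, rfl⟩; exact hy n)
  exact congrFun this x

end Pairing

/-- `F` is the componentwise Fourier transform of the `L²` tensor field `f`. -/
def IsTensorFT (f : TensorField) (F : E3 → Matrix (Fin 3) (Fin 3) ℂ) : Prop :=
  ∀ j k, IsFourierPair (fun x => (f x j k : ℂ)) (fun y => F y j k)

/-- The quadratic form `F y` vanishes on the orthogonal complement of `y`. For a Fourier transform
this says that the tensor field is a potential field, that is, of the form `d v`. -/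
def VanishesOnOrthogonal (F : E3 → Matrix (Fin 3) (Fin 3) ℂ) : Prop :=
  ∀ᵐ y : E3, ∀ w : E3, inner ℝ w y = 0 → ∑ j, ∑ k, F y j k * w j * w k = 0

theorem exists_isTensorFT {f : TensorField} (hf : ∀ j k, MemLp (fun x => f x j k) 2 volume) :
    ∃ F, IsTensorFT f F := by
  choose F hF using fun j k => exists_isFourierPair (hf j k).ofReal (E := E3)
  exact ⟨fun y => Matrix.of fun j k => F j k y, hF⟩

theorem IsTensorFT.unique_left {f g : TensorField} {F : E3 → Matrix (Fin 3) (Fin 3) ℂ}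
    (hf : IsTensorFT f F) (hg : IsTensorFT g F) : ∀ᵐ x, f x = g x := by
  have := ae_all_iff.2 fun j => ae_all_iff.2 fun k => (hf j k).unique_left (hg j k)
  filter_upwards [this] with x hx
  ext j k
  exact_mod_cast hx j k

theorem IsTensorFT.congr {f : TensorField} {F G : E3 → Matrix (Fin 3) (Fin 3) ℂ}
    (hF : IsTensorFT f F) (h : ∀ᵐ y, F y = G y) : IsTensorFT f G := fun j k =>
  (hF j k).congr EventuallyEq.rfl (by filter_upwards [h] with y hy; rw [hy])

theorem lineDerivOp_apply_ofReal {g : E3 → ℝ} (hg : ContDiff ℝ ∞ g) {φ : 𝓢(E3, ℂ)}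
    (hφ : ∀ x, φ x = (g x : ℂ)) (m x : E3) : ∂_{m} φ x = (fderiv ℝ g x m : ℂ) := by
  rw [lineDerivOp_apply_eq_fderiv]
  have : (φ : E3 → ℂ) = Complex.ofRealCLM ∘ g := funext hφ
  rw [this, fderiv_comp _ Complex.ofRealCLM.differentiableAt
    (hg.differentiable (by simp) x), ContinuousLinearMap.fderiv]
  rfl

/-- A field is solenoidal exactly when its Fourier transform annihilates the frequency vector. -/
theorem isSolenoidal_iff {f : TensorField} {F : E3 → Matrix (Fin 3) (Fin 3) ℂ}
    (hF : IsTensorFT f F) :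
    IsSolenoidal f ↔ ∀ᵐ y : E3, ∀ j, ∑ k, F y j k * (y k : ℂ) = 0 := by
  have hin : ∀ (y : E3) (k : Fin 3), inner ℝ y (EuclideanSpace.single k (1 : ℝ)) = y k := by
    intro y k; simp [EuclideanSpace.inner_single_right]
  -- the pairing of `∂_k 𝓕 θ` with the components of a row, moved to the Fourier side
  have key : ∀ (j : Fin 3) (θ : 𝓢(E3, ℂ)),
      (∀ k, Integrable (fun y : E3 => θ y * (F y j k * (y k : ℂ)))) ∧
      ∑ k, ∫ x, (∂_{EuclideanSpace.single k (1 : ℝ)} (𝓕 θ) : 𝓢(E3, ℂ)) x * (f x j k : ℂ) =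
        -(2 * Real.pi * Complex.I) * ∫ y, θ y * ∑ k, F y j k * (y k : ℂ) := by
    intro j θ
    choose θ' hθ' hd using fun k : Fin 3 =>
      lineDerivOp_fourier_apply θ (EuclideanSpace.single k (1 : ℝ))
    have hpi : (-(2 * Real.pi * Complex.I)) ≠ 0 := neg_ne_zero.2 Complex.two_pi_I_ne_zero
    have hint : ∀ k, Integrable (fun y : E3 => θ y * (F y j k * (y k : ℂ))) := by
      intro k
      have := (integrable_schwartz_mul (θ' k) (hF j k).2).const_mul
        (-(2 * Real.pi * Complex.I))⁻¹
      refine this.congr (Eventually.of_forall fun y => ?_)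
      simp only [hθ', hin]
      field_simp
    refine ⟨hint, ?_⟩
    simp_rw [Finset.mul_sum]
    rw [integral_finsetSum _ fun k _ => hint k, Finset.mul_sum]
    refine Finset.sum_congr rfl fun k _ => ?_
    rw [hd, ← (hF j k).3, ← integral_const_mul]
    refine integral_congr_ae (Eventually.of_forall fun y => ?_)
    simp only [hθ', hin]
    ring
  constructor
  · intro h
    rw [ae_all_iff]
    intro j
    have hS : ∀ φ : 𝓢(E3, ℂ), ∑ k, ∫ x, (lineDerivOpCLM ℂ 𝓢(E3, ℂ)
        (EuclideanSpace.single k (1 : ℝ)) φ : 𝓢(E3, ℂ)) x * (f x j k : ℂ) = 0 := by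
      refine sum_pairing_eq_zero_of_real_test (fun k => (hF j k).1) _ fun g hg hc φ hφ => ?_
      have := congrArg ((↑) : ℝ → ℂ) (h j g ⟨hg, hc⟩)
      rw [Complex.ofReal_sum] at this
      rw [Complex.ofReal_zero] at this
      rw [← this]
      refine Finset.sum_congr rfl fun k _ => ?_
      rw [← integral_complex_ofReal]
      refine integral_congr_ae (Eventually.of_forall fun x => ?_)
      simp only [lineDerivOpCLM_apply, lineDerivOp_apply_ofReal hg hφ, partialDeriv]
      push_cast; ring
    refine ae_eq_zero_of_schwartz ?_ fun θ => ?_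
    · have : ∀ k, LocallyIntegrable (fun y : E3 => F y j k * (y k : ℂ)) volume := by
        intro k
        have h1 := ((hF j k).2.locallyIntegrable one_le_two)
        exact h1.mul_continuous (by fun_prop)
      exact locallyIntegrable_finsetSum _ fun k _ => this k
    · have h1 := (key j θ).2
      have h2 := hS (𝓕 θ)
      simp only [lineDerivOpCLM_apply] at h2
      rw [h2] at h1
      exact (mul_eq_zero.1 h1.symm).resolve_left (neg_ne_zero.2 Complex.two_pi_I_ne_zero)
  · intro h j g hg
    have c1 : HasCompactSupport (fun x => (g x : ℂ)) := hg.2.comp_left (g := ((↑) : ℝ → ℂ)) rfl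
    let φ : 𝓢(E3, ℂ) := c1.toSchwartzMap (Complex.ofRealCLM.contDiff.comp hg.1)
    have h1 := (key j (𝓕⁻ φ)).2
    rw [fourier_fourierInv_eq] at h1
    have h2 : ∫ y, (𝓕⁻ φ) y * ∑ k, F y j k * (y k : ℂ) = 0 := by
      rw [← integral_zero E3 ℂ (μ := volume)]
      refine integral_congr_ae ?_
      filter_upwards [h] with y hy
      rw [hy j, mul_zero]
    rw [h2, mul_zero] at h1
    apply Complex.ofReal_injective
    rw [Complex.ofReal_sum, Complex.ofReal_zero, ← h1]
    refine Finset.sum_congr rfl fun k _ => ?_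
    rw [← integral_complex_ofReal]
    refine integral_congr_ae (Eventually.of_forall fun x => ?_)
    simp only [lineDerivOp_apply_ofReal hg.1 (φ := φ) (fun _ => rfl), partialDeriv]
    push_cast; ring

/-! ### Inner derivatives are potential on the Fourier side -/

/-- The operator `p_j ∂_q - q_j ∂_p`. Its symbol is the `j`-th component of a vector orthogonal to
the frequency, so that the divergence of the vector of these operators vanishes. -/
noncomputable def curlOp (p q : E3) (j : Fin 3) : 𝓢(E3, ℂ) →L[ℂ] 𝓢(E3, ℂ) :=
  (p j : ℂ) • lineDerivOpCLM ℂ 𝓢(E3, ℂ) q - (q j : ℂ) • lineDerivOpCLM ℂ 𝓢(E3, ℂ) p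

theorem curlOp_apply (p q : E3) (j : Fin 3) (φ : 𝓢(E3, ℂ)) :
    curlOp p q j φ = (p j : ℂ) • ∂_{q} φ - (q j : ℂ) • ∂_{p} φ := rfl

/-- The operator `curlOp` on real-valued functions. -/
noncomputable def realCurlOp (p q : E3) (j : Fin 3) (g : E3 → ℝ) (x : E3) : ℝ :=
  p j * fderiv ℝ g x q - q j * fderiv ℝ g x p

theorem isTestFunction_fderiv_apply {g : E3 → ℝ} (hg : IsTestFunction g) (m : E3) :
    IsTestFunction fun x => fderiv ℝ g x m :=
  ⟨(hg.1.fderiv_right (m := ∞) (by simp)).clm_apply contDiff_const, hg.2.fderiv_apply ℝ m⟩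

theorem isTestFunction_realCurlOp {g : E3 → ℝ} (hg : IsTestFunction g) (p q : E3) (j : Fin 3) :
    IsTestFunction (realCurlOp p q j g) := by
  have h1 := isTestFunction_fderiv_apply hg q
  have h2 := isTestFunction_fderiv_apply hg p
  refine ⟨(contDiff_const.mul h1.1).sub (contDiff_const.mul h2.1), ?_⟩
  exact (h1.2.mul_left (f := fun _ => p j)).sub (h2.2.mul_left (f := fun _ => q j))

theorem curlOp_apply_ofReal {g : E3 → ℝ} (hg : IsTestFunction g) {φ : 𝓢(E3, ℂ)}
    (hφ : ∀ x, φ x = (g x : ℂ)) (p q : E3) (j : Fin 3) (x : E3) :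
    curlOp p q j φ x = (realCurlOp p q j g x : ℂ) := by
  rw [curlOp_apply]
  simp [lineDerivOp_apply_ofReal hg.1 hφ, realCurlOp]

theorem curlOp_comm (p q : E3) (j k : Fin 3) (φ : 𝓢(E3, ℂ)) :
    curlOp p q j (curlOp p q k φ) = curlOp p q k (curlOp p q j φ) := by
  simp only [curlOp_apply, sub_eq_add_neg, lineDerivOp_add, lineDerivOp_smul, lineDerivOp_neg,
    lineDerivOp_comm φ q p]
  ext x
  simp
  ring

theorem sum_smul_lineDerivOp_single (p : E3) (φ : 𝓢(E3, ℂ)) :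
    ∑ j, (p j : ℂ) • ∂_{EuclideanSpace.single j (1 : ℝ)} φ = ∂_{p} φ := by
  ext x
  have hp : p = ∑ j, p j • EuclideanSpace.single j (1 : ℝ) := by
    ext i; simp [Pi.single_apply]
  rw [lineDerivOp_apply_eq_fderiv]
  conv_rhs => rw [hp, map_sum]
  simp [lineDerivOp_apply_eq_fderiv]

/-- The divergence of the vector of operators `curlOp p q j` vanishes. -/
theorem sum_lineDerivOp_curlOp (p q : E3) (φ : 𝓢(E3, ℂ)) :
    ∑ j, ∂_{EuclideanSpace.single j (1 : ℝ)} (curlOp p q j φ) = 0 := by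
  simp only [curlOp_apply, sub_eq_add_neg, lineDerivOp_add, lineDerivOp_smul, lineDerivOp_neg]
  rw [Finset.sum_add_distrib, Finset.sum_neg_distrib, sum_smul_lineDerivOp_single,
    sum_smul_lineDerivOp_single, lineDerivOp_comm, add_neg_cancel]

theorem curlOp_fourier (p q : E3) (j : Fin 3) (θ : 𝓢(E3, ℂ)) :
    ∃ θ' : 𝓢(E3, ℂ), (∀ y : E3, θ' y = -(2 * Real.pi * Complex.I) *
      ((p j * inner ℝ y q - q j * inner ℝ y p : ℝ) : ℂ) * θ y) ∧
      curlOp p q j (𝓕 θ) = 𝓕 θ' := by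
  obtain ⟨a, ha, ha'⟩ := lineDerivOp_fourier_apply θ q
  obtain ⟨b, hb, hb'⟩ := lineDerivOp_fourier_apply θ p
  refine ⟨(p j : ℂ) • a - (q j : ℂ) • b, fun y => ?_, ?_⟩
  · simp [ha, hb]; ring
  · rw [curlOp_apply, ha', hb', sub_eq_add_neg, sub_eq_add_neg, FourierTransform.fourier_add,
      FourierTransform.fourier_neg, FourierTransform.fourier_smul, FourierTransform.fourier_smul]

/-- Pairing with a divergence-free symmetric test tensor annihilates inner derivatives. -/
theorem sum_integral_mul_realCurlOp {v : E3 → E3} {h : TensorField}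
    (hv : LocallyIntegrable v volume) (hd : IsInnerDeriv v h) (p q : E3) {g : E3 → ℝ}
    (hg : IsTestFunction g) :
    ∑ j, ∑ k, ∫ x, h x j k * realCurlOp p q j (realCurlOp p q k g) x = 0 := by
  have c1 : HasCompactSupport (fun x => (g x : ℂ)) := hg.2.comp_left (g := ((↑) : ℝ → ℂ)) rfl
  let φ : 𝓢(E3, ℂ) := c1.toSchwartzMap (Complex.ofRealCLM.contDiff.comp hg.1)
  set T : Fin 3 → Fin 3 → E3 → ℝ := fun j k => realCurlOp p q j (realCurlOp p q k g) with hT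
  have htest : ∀ j k, IsTestFunction (T j k) := fun j k =>
    isTestFunction_realCurlOp (isTestFunction_realCurlOp hg p q k) p q j
  have h1 : ∀ k x, curlOp p q k φ x = (realCurlOp p q k g x : ℂ) := fun k x =>
    curlOp_apply_ofReal hg (fun _ => rfl) p q k x
  have h2 : ∀ j k x, curlOp p q j (curlOp p q k φ) x = (T j k x : ℂ) := fun j k x =>
    curlOp_apply_ofReal (isTestFunction_realCurlOp hg p q k) (h1 k) p q j x
  have hsymm : ∀ j k, T j k = T k j := by
    intro j k
    ext x
    apply Complex.ofReal_injective
    rw [← h2, ← h2, curlOp_comm]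
  have hdiv : ∀ k x, ∑ j, partialDeriv j (T j k) x = 0 := by
    intro k x
    apply Complex.ofReal_injective
    have := congrArg (fun f : 𝓢(E3, ℂ) => f x) (sum_lineDerivOp_curlOp p q (curlOp p q k φ))
    simp only [sum_apply] at this
    simp only [lineDerivOp_apply_ofReal (htest _ k).1 (h2 _ k)] at this
    simpa [partialDeriv] using this
  have hint : ∀ i j k l, Integrable (fun x => v x i * partialDeriv j (T k l) x) volume := by
    intro i j k l
    have ht := isTestFunction_fderiv_apply (htest k l) (EuclideanSpace.single j 1)
    have hvi : LocallyIntegrable (fun x => v x i) volume := by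
      intro x
      obtain ⟨s, hs, hi⟩ := hv x
      exact ⟨s, hs, (EuclideanSpace.proj (𝕜 := ℝ) i).integrable_comp hi⟩
    have := hvi.integrable_smul_left_of_hasCompactSupport ht.1.continuous ht.2
    refine this.congr (Eventually.of_forall fun x => ?_)
    simp [partialDeriv, mul_comm]
  have hA : ∀ k, ∑ j, ∫ x, v x k * partialDeriv j (T j k) x = 0 := by
    intro k
    rw [← integral_finsetSum _ fun j _ => hint _ _ _ _]
    simp [← Finset.mul_sum, hdiv]
  have hsplit : ∀ j k, ∫ x, h x j k * T j k x = -((1 / 2 : ℝ) *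
      (∫ x, v x k * partialDeriv j (T j k) x)) +
      -((1 / 2 : ℝ) * ∫ x, v x j * partialDeriv k (T k j) x) := by
    intro j k
    rw [hd j k _ (htest j k), integral_add (hint _ _ _ _) (hint _ _ _ _), hsymm k j]
    ring
  rw [Finset.sum_congr rfl fun j _ => Finset.sum_congr rfl fun k _ => hsplit j k]
  simp_rw [Finset.sum_add_distrib, Finset.sum_neg_distrib, ← Finset.mul_sum]
  rw [Finset.sum_comm]
  simp [hA]

/-- The Fourier transform of an `L²` inner derivative vanishes on the complement of the frequency.
The covector field `v` need not be tempered, so the equation `h = d v` is tested with the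
divergence-free tensors `(p_j ∂_q - q_j ∂_p)(p_k ∂_q - q_k ∂_p) g`, which eliminate `v`. -/
theorem vanishesOnOrthogonal_of_isInnerDeriv {v : E3 → E3} {h : TensorField}
    {F : E3 → Matrix (Fin 3) (Fin 3) ℂ} (hv : LocallyIntegrable v volume)
    (hd : IsInnerDeriv v h) (hF : IsTensorFT h F) : VanishesOnOrthogonal F := by
  -- the symbol of the operators `curlOp`
  let m : E3 × E3 → E3 → Fin 3 → ℝ := fun z y j => z.1 j * inner ℝ y z.2 - z.2 j * inner ℝ y z.1
  have key : ∀ z : E3 × E3, ∀ᵐ y, ∑ j, ∑ k, F y j k * (m z y j : ℂ) * (m z y k : ℂ) = 0 := by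
    rintro ⟨p, q⟩
    have hS : ∀ φ : 𝓢(E3, ℂ), ∑ i : Fin 3 × Fin 3, ∫ x,
        ((curlOp p q i.1 ∘L curlOp p q i.2) φ : 𝓢(E3, ℂ)) x * (h x i.1 i.2 : ℂ) = 0 := by
      refine sum_pairing_eq_zero_of_real_test (fun i : Fin 3 × Fin 3 => (hF i.1 i.2).1)
        (fun i : Fin 3 × Fin 3 => curlOp p q i.1 ∘L curlOp p q i.2) fun g hg hc φ hφ => ?_
      have := congrArg ((↑) : ℝ → ℂ) (sum_integral_mul_realCurlOp hv hd p q ⟨hg, hc⟩)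
      rw [Complex.ofReal_zero] at this
      rw [← this, Fintype.sum_prod_type]
      push_cast
      refine Finset.sum_congr rfl fun j _ => Finset.sum_congr rfl fun k _ => ?_
      rw [← integral_complex_ofReal]
      refine integral_congr_ae (Eventually.of_forall fun x => ?_)
      have h1 : ∀ x, curlOp p q k φ x = (realCurlOp p q k g x : ℂ) := fun x =>
        curlOp_apply_ofReal ⟨hg, hc⟩ hφ p q k x
      have h2 := curlOp_apply_ofReal (isTestFunction_realCurlOp ⟨hg, hc⟩ p q k) h1 p q j x
      change curlOp p q j (curlOp p q k φ) x * (h x j k : ℂ) = _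
      rw [h2]
      push_cast; ring
    refine ae_eq_zero_of_schwartz ?_ fun θ => ?_
    · refine locallyIntegrable_finsetSum _ fun j _ => locallyIntegrable_finsetSum _ fun k _ => ?_
      have h1 := ((hF j k).2.locallyIntegrable one_le_two)
      exact (h1.mul_continuous (by fun_prop)).mul_continuous (by fun_prop)
    · have hterm : ∀ j k, Integrable (fun y => θ y * (F y j k * (m (p, q) y j : ℂ) *
            (m (p, q) y k : ℂ))) ∧
          ∫ x, ((curlOp p q j ∘L curlOp p q k) (𝓕 θ) : 𝓢(E3, ℂ)) x * (h x j k : ℂ) =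
            (-(2 * Real.pi * Complex.I)) ^ 2 * ∫ y, θ y * (F y j k * (m (p, q) y j : ℂ) *
            (m (p, q) y k : ℂ)) := by
        intro j k
        obtain ⟨a, ha, ha'⟩ := curlOp_fourier p q k θ
        obtain ⟨b, hb, hb'⟩ := curlOp_fourier p q j a
        have hab : ∀ y, b y * F y j k = (-(2 * Real.pi * Complex.I)) ^ 2 *
            (θ y * (F y j k * (m (p, q) y j : ℂ) * (m (p, q) y k : ℂ))) := by
          intro y; rw [hb, ha]; simp only [m]; ring
        have hne : (-(2 * Real.pi * Complex.I)) ^ 2 ≠ 0 :=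
          pow_ne_zero _ (neg_ne_zero.2 Complex.two_pi_I_ne_zero)
        constructor
        · have := (integrable_schwartz_mul b (hF j k).2).const_mul
            ((-(2 * Real.pi * Complex.I)) ^ 2)⁻¹
          refine this.congr (Eventually.of_forall fun y => ?_)
          simp only [hab]
          rw [inv_mul_cancel_left₀ hne]
        · rw [ContinuousLinearMap.comp_apply, ha', hb', ← (hF j k).3, ← integral_const_mul]
          exact integral_congr_ae (Eventually.of_forall hab)
      have h1 := hS (𝓕 θ)
      rw [Fintype.sum_prod_type] at h1
      simp_rw [(hterm _ _).2, ← Finset.mul_sum] at h1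
      have h2 := (mul_eq_zero.1 h1).resolve_left
        (pow_ne_zero _ (neg_ne_zero.2 Complex.two_pi_I_ne_zero))
      simp_rw [Finset.mul_sum]
      rw [integral_finsetSum _ fun j _ => integrable_finsetSum _ fun k _ => (hterm j k).1, ← h2]
      refine Finset.sum_congr rfl fun j _ => ?_
      rw [integral_finsetSum _ fun k _ => (hterm j k).1]
  have hall := ae_forall_eq_zero_of_continuous (μ := (volume : Measure E3))
    (G := fun y (z : E3 × E3) => ∑ j, ∑ k, F y j k * (m z y j : ℂ) * (m z y k : ℂ))
    (fun y => by fun_prop) key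
  have hne : ∀ᵐ y : E3, y ≠ 0 := Measure.ae_ne volume 0
  filter_upwards [hall, hne] with y hy hy0 w hw
  -- for `w ⊥ y` the symbol with `p = w` and `q = y / |y|²` is `w` itself
  have := hy (w, (‖y‖ ^ 2)⁻¹ • y)
  have hn : ‖y‖ ^ 2 ≠ 0 := pow_ne_zero _ (norm_ne_zero_iff.2 hy0)
  have hm : ∀ j, m (w, (‖y‖ ^ 2)⁻¹ • y) y j = w j := by
    intro j
    simp only [m, inner_smul_right, real_inner_self_eq_norm_sq, real_inner_comm w y] at hw ⊢
    rw [hw, inv_mul_cancel₀ hn]; simp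
  simpa [hm] using this

/-! ### The solenoidal part of a multiple of the metric -/

/-- The orthogonal projection onto the complement of `y`, as a matrix (the identity for `y = 0`,
by the convention `0⁻¹ = 0`). -/
noncomputable def orthProj (y : E3) : Matrix (Fin 3) (Fin 3) ℝ :=
  Matrix.of fun j k => (if j = k then 1 else 0) - y j * y k * (‖y‖ ^ 2)⁻¹

theorem abs_coord_le (y : E3) (k : Fin 3) : |y k| ≤ ‖y‖ := by
  simpa using PiLp.norm_apply_le y k

theorem abs_coord_mul_le (y : E3) (j k : Fin 3) : |y j * y k * (‖y‖ ^ 2)⁻¹| ≤ 1 := by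
  rw [abs_mul, abs_mul, abs_of_nonneg (by positivity : 0 ≤ (‖y‖ ^ 2)⁻¹), ← div_eq_mul_inv]
  refine div_le_one_of_le₀ ?_ (by positivity)
  rw [sq]
  exact mul_le_mul (abs_coord_le y j) (abs_coord_le y k) (abs_nonneg _) (norm_nonneg _)

theorem sum_coord_sq (y : E3) : ∑ k, y k * y k = ‖y‖ ^ 2 := by
  rw [EuclideanSpace.real_norm_sq_eq]
  exact Finset.sum_congr rfl fun k _ => (sq _).symm

theorem sum_orthProj_mul (y : E3) (j : Fin 3) : ∑ k, orthProj y j k * y k = 0 := by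
  rcases eq_or_ne y 0 with rfl | hy
  · simp
  have hn : ‖y‖ ^ 2 ≠ 0 := pow_ne_zero _ (norm_ne_zero_iff.2 hy)
  have : ∀ k, orthProj y j k * y k =
      (if j = k then y k else 0) - y j * (‖y‖ ^ 2)⁻¹ * (y k * y k) := by
    intro k; simp only [orthProj, Matrix.of_apply]; split_ifs <;> ring
  simp_rw [this, Finset.sum_sub_distrib, ← Finset.mul_sum, sum_coord_sq]
  simp [hn]

theorem trace_orthProj {y : E3} (hy : y ≠ 0) : (orthProj y).trace = 2 := by
  have hn : ‖y‖ ^ 2 ≠ 0 := pow_ne_zero _ (norm_ne_zero_iff.2 hy)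
  simp only [Matrix.trace, Matrix.diag, orthProj, Matrix.of_apply, if_true]
  rw [Finset.sum_sub_distrib, ← Finset.sum_mul, sum_coord_sq, mul_inv_cancel₀ hn]
  norm_num

theorem orthProj_symm (y : E3) (j k : Fin 3) : orthProj y j k = orthProj y k j := by
  simp only [orthProj, Matrix.of_apply, eq_comm (a := j), mul_comm (y j)]

theorem orthProj_neg (y : E3) : orthProj (-y) = orthProj y := by
  ext j k; simp [orthProj]

theorem measurable_orthProj (j k : Fin 3) : Measurable fun y : E3 => orthProj y j k := by
  simp only [orthProj, Matrix.of_apply]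
  fun_prop

theorem memLp_mul_of_bound {A : E3 → ℂ} (hA : MemLp A 2 volume) {c : E3 → ℂ} (hc : Measurable c)
    {C : ℝ} (hC : ∀ y, ‖c y‖ ≤ C) : MemLp (fun y => A y * c y) 2 volume := by
  refine MemLp.of_le_mul (c := C) hA (hA.1.mul hc.aestronglyMeasurable)
    (Eventually.of_forall fun y => ?_)
  rw [norm_mul, mul_comm]
  exact mul_le_mul_of_nonneg_right (hC y) (norm_nonneg _)

theorem norm_orthProj_le (y : E3) (j k : Fin 3) : ‖(orthProj y j k : ℂ)‖ ≤ 2 := by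
  rw [Complex.norm_real, Real.norm_eq_abs]
  simp only [orthProj, Matrix.of_apply]
  refine (abs_sub _ _).trans ?_
  have h1 := abs_coord_mul_le y j k
  have h2 : |(if j = k then (1 : ℝ) else 0)| ≤ 1 := by split_ifs <;> simp
  linarith

/-- The tensor field with Fourier transform `A P`, where `A` is the transform of a real function
and `P` the projection onto the complement of the frequency. It is real since `A P` is
conjugate-symmetric. -/
theorem exists_tensor_of_orthProj {α : E3 → ℝ} {A : E3 → ℂ}
    (hA : IsFourierPair (fun x => (α x : ℂ)) A) :
    ∃ f : TensorField, IsTensorFT f fun y => Matrix.of fun j k => A y * (orthProj y j k : ℂ) := by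
  have hmem : ∀ j k, MemLp (fun y => A y * (orthProj y j k : ℂ)) 2 volume := fun j k =>
    memLp_mul_of_bound hA.2 (Complex.measurable_ofReal.comp (measurable_orthProj j k))
      fun y => norm_orthProj_le y j k
  choose w hw using fun j k => exists_isFourierPair_inv (hmem j k)
  have hsymm : (fun y => conj (A (-y))) =ᵐ[volume] A := by
    have := hA.conj
    simp only [Complex.conj_ofReal] at this
    exact this.unique_right hA
  have hreal : ∀ j k, (fun x => conj (w j k x)) =ᵐ[volume] w j k := by
    intro j k
    refine IsFourierPair.unique_left ((hw j k).conj.congr EventuallyEq.rfl ?_) (hw j k)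
    filter_upwards [hsymm] with y hy
    rw [map_mul, hy, Complex.conj_ofReal, orthProj_neg]
  refine ⟨fun x => Matrix.of fun j k => (w j k x).re, fun j k => ?_⟩
  refine (hw j k).congr ?_ EventuallyEq.rfl
  filter_upwards [hreal j k] with x hx
  exact (Complex.conj_eq_iff_re.1 hx).symm

/-- In dimension three the singularity `‖y‖⁻²` is integrable. -/
theorem integrableOn_ball_inv_norm_sq :
    IntegrableOn (fun y : E3 => ‖y‖⁻¹ ^ 2) (Metric.ball 0 1) := by
  rw [integrableOn_fun_norm_addHaar volume (f := fun r : ℝ => r⁻¹ ^ 2)]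
  refine (integrableOn_const (C := (1 : ℝ)) (by simp)).congr_fun (fun r hr => ?_)
    measurableSet_Ioo
  have : r ≠ 0 := hr.1.ne'
  simp [this]

theorem memLp_indicator_inv_norm :
    MemLp ((Metric.ball (0 : E3) 1).indicator fun y => (‖y‖⁻¹ : ℝ)) 2 volume := by
  have hm : Measurable ((Metric.ball (0 : E3) 1).indicator fun y => (‖y‖⁻¹ : ℝ)) :=
    measurable_norm.inv.indicator Metric.isOpen_ball.measurableSet
  rw [memLp_two_iff_integrable_sq hm.aestronglyMeasurable]
  have := integrableOn_ball_inv_norm_sq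
  rw [← integrable_indicator_iff Metric.isOpen_ball.measurableSet] at this
  refine this.congr (Eventually.of_forall fun y => ?_)
  by_cases hy : y ∈ Metric.ball (0 : E3) 1
  · simp only [Set.indicator_of_mem hy]
  · simp only [Set.indicator_of_notMem hy]; norm_num

/-- The multiplier `y_k / (2πi|y|²)`, which turns the transform of `α` into the transform of a
covector field `v` whose inner derivative is the potential part of `α g`. -/
noncomputable def potMul (k : Fin 3) (y : E3) : ℂ :=
  (2 * Real.pi * Complex.I)⁻¹ * ((y k * (‖y‖ ^ 2)⁻¹ : ℝ) : ℂ)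

theorem measurable_potMul (k : Fin 3) : Measurable (potMul k) := by
  unfold potMul
  fun_prop

theorem norm_potMul_le (k : Fin 3) (y : E3) : ‖potMul k y‖ ≤ ‖y‖⁻¹ := by
  rw [potMul, norm_mul, Complex.norm_real, Real.norm_eq_abs, abs_mul,
    abs_of_nonneg (by positivity : 0 ≤ (‖y‖ ^ 2)⁻¹)]
  have h1 : ‖(2 * Real.pi * Complex.I)⁻¹‖ ≤ 1 := by
    rw [norm_inv]
    refine inv_le_one_of_one_le₀ ?_
    simp only [norm_mul, Complex.norm_I, Complex.norm_real, Complex.norm_ofNat, mul_one,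
      Real.norm_eq_abs, abs_of_pos Real.pi_pos]
    linarith [Real.pi_gt_three]
  have h2 : |y k| * (‖y‖ ^ 2)⁻¹ ≤ ‖y‖⁻¹ := by
    rcases eq_or_ne y 0 with rfl | hy
    · simp
    have hn : ‖y‖ ≠ 0 := norm_ne_zero_iff.2 hy
    calc |y k| * (‖y‖ ^ 2)⁻¹ ≤ ‖y‖ * (‖y‖ ^ 2)⁻¹ := by gcongr; exact abs_coord_le y k
      _ = ‖y‖⁻¹ := by field_simp
  calc _ ≤ 1 * ‖y‖⁻¹ := by gcongr
    _ = ‖y‖⁻¹ := one_mul _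

/-- The product of an `L²` function with the multiplier `potMul` is the sum of an integrable
function, supported by low frequencies, and an `L²` function. -/
theorem exists_potMul_split {A : E3 → ℂ} (hA : MemLp A 2 volume) (k : Fin 3) :
    ∃ l h : E3 → ℂ, Integrable l volume ∧ MemLp h 2 volume ∧
      ∀ y, l y + h y = A y * potMul k y := by
  have hB : MeasurableSet (Metric.ball (0 : E3) 1) := Metric.isOpen_ball.measurableSet
  refine ⟨fun y => A y * (Metric.ball (0 : E3) 1).indicator (potMul k) y,
    fun y => A y * (Metric.ball (0 : E3) 1)ᶜ.indicator (potMul k) y, ?_, ?_, fun y => ?_⟩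
  · refine MemLp.integrable_mul hA (q := 2) ?_
    refine memLp_indicator_inv_norm.of_le
      ((measurable_potMul k).indicator hB).aestronglyMeasurable (Eventually.of_forall fun y => ?_)
    by_cases hy : y ∈ Metric.ball (0 : E3) 1
    · simpa [Set.indicator_of_mem hy] using norm_potMul_le k y
    · simp [Set.indicator_of_notMem hy]
  · refine memLp_mul_of_bound hA ((measurable_potMul k).indicator hB.compl) (C := 1) fun y => ?_
    by_cases hy : y ∈ Metric.ball (0 : E3) 1
    · simp [hy]
    · have hy' : y ∈ (Metric.ball (0 : E3) 1)ᶜ := hy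
      rw [Set.indicator_of_mem hy']
      refine (norm_potMul_le k y).trans (inv_le_one_of_one_le₀ ?_)
      simpa using hy
  · by_cases hy : y ∈ Metric.ball (0 : E3) 1 <;> simp [hy]

theorem volume_norm_gt_lt_top_of_tendsto {a : E3 → ℂ} (ha : Tendsto a (cocompact E3) (𝓝 0))
    {ε : ℝ} (hε : 0 < ε) : volume {x | ε < ‖a x‖} < ⊤ := by
  have h1 : ∀ᶠ x in cocompact E3, ‖a x‖ < ε := by
    have := ha.norm
    rw [norm_zero] at this
    exact this.eventually_lt_const hε
  obtain ⟨K, hK, hKs⟩ := mem_cocompact.1 h1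
  refine (measure_mono fun x hx => ?_).trans_lt hK.measure_lt_top
  by_contra hxK
  have h2 : ε < ‖a x‖ := hx
  exact lt_asymm (hKs hxK) h2

theorem volume_norm_gt_lt_top_of_memLp {b : E3 → ℂ} (hb : MemLp b 2 volume)
    {ε : ℝ} (hε : 0 < ε) : volume {x | ε < ‖b x‖} < ⊤ := by
  have h := meas_ge_le_mul_pow_eLpNorm_enorm volume (p := 2) (by norm_num) (by norm_num) hb.1
    (ε := ENNReal.ofReal ε) (by simpa using hε) (by simp)
  refine (measure_mono fun x hx => ?_).trans_lt (h.trans_lt ?_)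
  · change ENNReal.ofReal ε ≤ ‖b x‖ₑ
    rw [← ofReal_norm]
    exact ENNReal.ofReal_le_ofReal (le_of_lt hx)
  · refine ENNReal.mul_lt_top ?_ ?_
    · simpa using hε
    · exact ENNReal.rpow_lt_top_of_nonneg (by norm_num) hb.2.ne

/-- There is a covector field `v`, vanishing at infinity, with Fourier transform
`A y / (2πi|y|²)`. Its low-frequency part is continuous and tends to zero by the Riemann–Lebesgue
lemma, its high-frequency part is square-integrable. -/
theorem exists_potential {A : E3 → ℂ} (hA : MemLp A 2 volume) :
    ∃ v : E3 → E3, LocallyIntegrable v volume ∧ VanishesAtInfinity v ∧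
      ∀ (k : Fin 3) (g : E3 → ℝ), IsTestFunction g → ∀ φ : 𝓢(E3, ℂ), (∀ x, φ x = (g x : ℂ)) →
        ∫ x, v x k * g x = (∫ y, 𝓕⁻ φ y * (A y * potMul k y)).re := by
  choose l h hl hh hlh using fun k => exists_potMul_split hA k
  choose b hb using fun k => exists_isFourierPair_inv (hh k)
  let a : Fin 3 → E3 → ℂ := fun k => 𝓕⁻ (l k)
  have hac : ∀ k, Continuous (a k) := fun k => continuous_fourierInv (hl k)
  have hbL : ∀ k, LocallyIntegrable (b k) volume := fun k =>
    (hb k).1.locallyIntegrable one_le_two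
  let v : E3 → E3 := fun x => ∑ k, (a k x + b k x).re • EuclideanSpace.single k (1 : ℝ)
  have hvk : ∀ x k, v x k = (a k x + b k x).re := by
    intro x k; simp [v, Pi.single_apply]
  have hab : ∀ k, LocallyIntegrable (fun x => a k x + b k x) volume := fun k =>
    (hac k).locallyIntegrable.add (hbL k)
  refine ⟨v, ?_, fun ε hε => ?_, fun k g hg φ hφ => ?_⟩
  · refine locallyIntegrable_finsetSum _ fun k _ x => ?_
    obtain ⟨s, hs, hi⟩ := hab k x
    exact ⟨s, hs, (Complex.reCLM.integrable_comp hi).smul_const _⟩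
  · have hsub : {x | ε < ‖v x‖} ⊆
        ⋃ k : Fin 3, ({x | ε / 6 < ‖a k x‖} ∪ {x | ε / 6 < ‖b k x‖}) := by
      intro x hx
      by_contra hc
      simp only [Set.mem_iUnion, Set.mem_union, Set.mem_ofPred_eq, not_exists, not_or,
        not_lt] at hc
      have h1 : ‖v x‖ ≤ ∑ k : Fin 3, ε / 3 := by
        refine (norm_sum_le _ _).trans (Finset.sum_le_sum fun k _ => ?_)
        rw [norm_smul, PiLp.norm_single, norm_one, mul_one, Real.norm_eq_abs]
        calc |(a k x + b k x).re| ≤ ‖a k x + b k x‖ := Complex.abs_re_le_norm _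
          _ ≤ ‖a k x‖ + ‖b k x‖ := norm_add_le _ _
          _ ≤ ε / 3 := by linarith [(hc k).1, (hc k).2]
      rw [Finset.sum_const, Finset.card_univ, Fintype.card_fin] at h1
      have : ε < ‖v x‖ := hx
      simp at h1
      linarith
    refine (measure_mono hsub).trans_lt ((measure_iUnion_le _).trans_lt ?_)
    rw [tsum_fintype]
    refine ENNReal.sum_lt_top.2 fun k _ =>
      (measure_union_le _ _).trans_lt (ENNReal.add_lt_top.2 ⟨?_, ?_⟩)
    · exact volume_norm_gt_lt_top_of_tendsto (tendsto_fourierInv_cocompact _) (by positivity)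
    · exact volume_norm_gt_lt_top_of_memLp (hb k).1 (by positivity)
  · have hφc : HasCompactSupport φ := by
      have : (φ : E3 → ℂ) = fun x => (g x : ℂ) := funext hφ
      rw [this]
      exact hg.2.comp_left (g := ((↑) : ℝ → ℂ)) rfl
    have ia : Integrable (fun x => φ x * a k x) volume := by
      have := (hac k).locallyIntegrable (μ := volume) |>.integrable_smul_left_of_hasCompactSupport
        φ.continuous hφc
      simpa using this
    have ib : Integrable (fun x => φ x * b k x) volume := integrable_schwartz_mul φ (hb k).1
    have e1 : ∫ x, φ x * a k x = ∫ y, 𝓕⁻ φ y * l k y := by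
      have := integral_fourier_mul_fourierInv (hl k) (𝓕⁻ φ)
      rwa [fourier_fourierInv_eq] at this
    have e2 : ∫ x, φ x * b k x = ∫ y, 𝓕⁻ φ y * h k y := (hb k).pairing_inv φ
    have il : Integrable (fun y => 𝓕⁻ φ y * l k y) volume := by
      obtain ⟨C, hC⟩ : ∃ C, ∀ y, ‖𝓕⁻ φ y‖ ≤ C :=
        ⟨_, fun y => SchwartzMap.norm_le_seminorm ℝ (𝓕⁻ φ) y⟩
      exact (hl k).bdd_mul (c := C) (𝓕⁻ φ).continuous.aestronglyMeasurable
        (Eventually.of_forall hC)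
    have ih : Integrable (fun y => 𝓕⁻ φ y * h k y) volume := integrable_schwartz_mul _ (hh k)
    have e3 : ∫ y, 𝓕⁻ φ y * (A y * potMul k y) = ∫ x, φ x * (a k x + b k x) := by
      simp_rw [← hlh k, mul_add]
      rw [integral_add il ih, integral_add ia ib, e1, e2]
    rw [e3]
    have i3 : Integrable (fun x => φ x * (a k x + b k x)) volume := by
      simp_rw [mul_add]; exact ia.add ib
    have := Complex.reCLM.integral_comp_comm i3
    rw [← Complex.reCLM_apply, ← this]
    refine integral_congr_ae (Eventually.of_forall fun x => ?_)
    simp only [hvk, hφ, Complex.reCLM_apply, Complex.re_ofReal_mul]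
    ring

/-- A tensor field with Fourier transform `A P`, where `A` is the transform of `α`, is the
solenoidal part of `α g`. -/
theorem isSolenoidalPart_of_isTensorFT {α : E3 → ℝ} {A : E3 → ℂ} {f : TensorField}
    (hA : IsFourierPair (fun x => (α x : ℂ)) A)
    (hf : IsTensorFT f fun y => Matrix.of fun j k => A y * (orthProj y j k : ℂ)) :
    IsSolenoidalPart (scalarTensor α) f := by
  refine ⟨⟨fun j k => (hf j k).1.re, ?_⟩, ?_, ?_⟩
  · have : ∀ j k, ∀ᵐ x, f x j k = f x k j := by
      intro j k
      have h2 : IsFourierPair (fun x => (f x k j : ℂ)) (fun y => A y * (orthProj y j k : ℂ)) :=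
        (hf k j).congr EventuallyEq.rfl
          (Eventually.of_forall fun y => by simp [orthProj_symm y j k])
      filter_upwards [(hf j k).unique_left h2] with x hx
      exact_mod_cast hx
    have := ae_all_iff.2 fun j => ae_all_iff.2 fun k => this j k
    filter_upwards [this] with x hx
    ext j k
    exact hx k j
  · rw [isSolenoidal_iff hf]
    refine Eventually.of_forall fun y j => ?_
    have := congrArg ((↑) : ℝ → ℂ) (sum_orthProj_mul y j)
    push_cast at this
    simp only [Matrix.of_apply, mul_assoc, ← Finset.mul_sum]
    rw [this, mul_zero]
  · obtain ⟨v, hv1, hv2, hv3⟩ := exists_potential hA.2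
    refine ⟨v, hv1, hv2, fun j k g hg => ?_⟩
    have c1 : HasCompactSupport (fun x => (g x : ℂ)) := hg.2.comp_left (g := ((↑) : ℝ → ℂ)) rfl
    let φ : 𝓢(E3, ℂ) := c1.toSchwartzMap (Complex.ofRealCLM.contDiff.comp hg.1)
    have hφ : ∀ x, φ x = (g x : ℂ) := fun _ => rfl
    -- the pairing of `v` with a derivative of the test function
    have hpair : ∀ j k : Fin 3, ∫ x, v x k * partialDeriv j g x =
        -(∫ y : E3, 𝓕⁻ φ y * (A y * ((y j * y k * (‖y‖ ^ 2)⁻¹ : ℝ) : ℂ))).re := by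
      intro j k
      have h1 := hv3 k _ (isTestFunction_fderiv_apply hg (EuclideanSpace.single j 1))
        (∂_{EuclideanSpace.single j (1 : ℝ)} φ) (lineDerivOp_apply_ofReal hg.1 hφ _)
      change ∫ x, v x k * fderiv ℝ g x (EuclideanSpace.single j 1) = _
      rw [h1, ← Complex.neg_re, ← integral_neg]
      congr 1
      refine integral_congr_ae (Eventually.of_forall fun y => ?_)
      have hpi := Complex.two_pi_I_ne_zero
      simp only [fourierInv_lineDerivOp_apply, EuclideanSpace.inner_single_right, potMul]
      push_cast
      field_simp
      simp
      ring
    have hi : ∀ j k : Fin 3, Integrable (fun x => v x k * partialDeriv j g x) volume := by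
      intro j k
      have ht := isTestFunction_fderiv_apply hg (EuclideanSpace.single j 1)
      have hvi : LocallyIntegrable (fun x => v x k) volume := by
        intro x
        obtain ⟨s, hs, hi⟩ := hv1 x
        exact ⟨s, hs, (EuclideanSpace.proj (𝕜 := ℝ) k).integrable_comp hi⟩
      have := hvi.integrable_smul_left_of_hasCompactSupport ht.1.continuous ht.2
      refine this.congr (Eventually.of_forall fun x => ?_)
      simp [partialDeriv, mul_comm]
    -- the Fourier transform of `α g - f`
    have hH : IsFourierPair (fun x => ((scalarTensor α x - f x) j k : ℂ))
        (fun y => A y * ((y j * y k * (‖y‖ ^ 2)⁻¹ : ℝ) : ℂ)) := by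
      have h0 := (hA.const_mul (if j = k then 1 else 0)).sub (hf j k)
      refine h0.congr (Eventually.of_forall fun x => ?_) (Eventually.of_forall fun y => ?_)
      · simp only [scalarTensor, Matrix.sub_apply, Matrix.smul_apply, Matrix.one_apply]
        split_ifs <;> simp
      · simp only [orthProj, Matrix.of_apply]
        split_ifs <;> push_cast <;> ring
    have hL : ∫ x, (scalarTensor α x - f x) j k * g x =
        (∫ y : E3, 𝓕⁻ φ y * (A y * ((y j * y k * (‖y‖ ^ 2)⁻¹ : ℝ) : ℂ))).re := by
      rw [← hH.pairing_inv φ, ← Complex.reCLM_apply,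
        ← Complex.reCLM.integral_comp_comm (integrable_schwartz_mul φ hH.1)]
      refine integral_congr_ae (Eventually.of_forall fun x => ?_)
      simp only [hφ, Complex.reCLM_apply, ← Complex.ofReal_mul, Complex.ofReal_re]
      ring
    have hswap : ∫ y : E3, 𝓕⁻ φ y * (A y * ((y k * y j * (‖y‖ ^ 2)⁻¹ : ℝ) : ℂ)) =
        ∫ y : E3, 𝓕⁻ φ y * (A y * ((y j * y k * (‖y‖ ^ 2)⁻¹ : ℝ) : ℂ)) :=
      integral_congr_ae (Eventually.of_forall fun y => by simp only [mul_comm (y k)])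
    rw [hL, integral_add (hi j k) (hi k j), hpair, hpair, hswap]
    ring

/-! ### Almost every line -/

/-- An integrable weight on `ℝ³`, positive everywhere. -/
noncomputable def rayWeight (x : E3) : ℝ≥0∞ := ENNReal.ofReal ((1 + ‖x‖) ^ (-4 : ℝ))

theorem measurable_rayWeight : Measurable rayWeight := by unfold rayWeight; fun_prop

theorem rayWeight_ne_zero (x : E3) : rayWeight x ≠ 0 := by
  have : (0 : ℝ) < (1 + ‖x‖) ^ (-4 : ℝ) := by positivity
  simpa [rayWeight] using this

theorem lintegral_rayWeight_ne_top : ∫⁻ x, rayWeight x ≠ ⊤ :=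
  (finite_integral_one_add_norm (by rw [finrank_euclideanSpace_fin]; norm_num)).ne

theorem l2_rayWeight_ne_top : l2 rayWeight ≠ ⊤ := by
  refine ENNReal.rpow_ne_top_of_nonneg (by norm_num) (ne_top_of_le_ne_top
    lintegral_rayWeight_ne_top (lintegral_mono fun x => ?_))
  have h1 : rayWeight x ≤ 1 := by
    rw [rayWeight, ENNReal.ofReal_le_one]
    exact Real.rpow_le_one_of_one_le_of_nonpos (by linarith [norm_nonneg x]) (by norm_num)
  calc rayWeight x ^ (2 : ℝ) ≤ rayWeight x ^ (1 : ℝ) :=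
        ENNReal.rpow_le_rpow_of_exponent_ge h1 (by norm_num)
    _ = rayWeight x := ENNReal.rpow_one _

theorem exists_bound_ray_prod {w₁ w₂ : E3 → ℝ≥0∞} (h₁ : Measurable w₁) (h₂ : Measurable w₂)
    (hw₁ : ∫⁻ x, w₁ x ≠ ⊤) (hw₂ : ∫⁻ x, w₂ x ≠ ⊤) (hl₁ : l2 w₁ ≠ ⊤) (hl₂ : l2 w₂ ≠ ⊤) :
    ∃ C : ℝ≥0∞, C ≠ ⊤ ∧ ∀ N : E3 → ℝ≥0∞, Measurable N →
      ∫⁻ p : E3 × E3, ∫⁻ t : ℝ, w₁ p.1 * w₂ p.2 * N (p.1 + t • p.2) ≤ C * l2 N := by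
  obtain ⟨C, hC, h⟩ := exists_bound_ray h₁ h₂ hw₁ hw₂ hl₁ hl₂
  refine ⟨C, hC, fun N hN => ?_⟩
  rw [lintegral_lintegral_swap (by fun_prop)]
  refine le_trans (le_of_eq (lintegral_congr fun t => ?_)) (h N hN)
  rw [Measure.volume_eq_prod, lintegral_prod _ (by fun_prop)]

/-- The weighted `L¹` norm over all lines of the line integrals of `N` is bounded by the `L²` norm
of `N`. -/
theorem exists_bound_rayWeight : ∃ C : ℝ≥0∞, C ≠ ⊤ ∧ ∀ N : E3 → ℝ≥0∞, Measurable N →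
    ∫⁻ p : E3 × E3, rayWeight p.1 * rayWeight p.2 * ∫⁻ t : ℝ, N (p.1 + t • p.2) ≤ C * l2 N := by
  obtain ⟨C, hC, h⟩ := exists_bound_ray_prod measurable_rayWeight measurable_rayWeight
    lintegral_rayWeight_ne_top lintegral_rayWeight_ne_top l2_rayWeight_ne_top l2_rayWeight_ne_top
  refine ⟨C, hC, fun N hN => le_trans (le_of_eq (lintegral_congr fun p => ?_)) (h N hN)⟩
  rw [lintegral_const_mul _ (by fun_prop)]

theorem measurable_lintegral_line {N : E3 → ℝ≥0∞} (hN : Measurable N) :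
    Measurable fun p : E3 × E3 => ∫⁻ t : ℝ, N (p.1 + t • p.2) := by
  have : Measurable fun q : (E3 × E3) × ℝ => N (q.1.1 + q.2 • q.1.2) := by fun_prop
  exact this.lintegral_prod_right'

theorem measurable_rayWeight_lintegral_line {N : E3 → ℝ≥0∞} (hN : Measurable N) :
    Measurable fun p : E3 × E3 =>
      rayWeight p.1 * rayWeight p.2 * ∫⁻ t : ℝ, N (p.1 + t • p.2) :=
  ((measurable_rayWeight.comp measurable_fst).mul
    (measurable_rayWeight.comp measurable_snd)).mul (measurable_lintegral_line hN)

theorem ae_lintegral_line_lt_top {N : E3 → ℝ≥0∞} (hN : Measurable N) (h2 : l2 N ≠ ⊤) :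
    ∀ᵐ p : E3 × E3, ∫⁻ t : ℝ, N (p.1 + t • p.2) < ⊤ := by
  obtain ⟨C, hC, h⟩ := exists_bound_rayWeight
  have := ae_lt_top (measurable_rayWeight_lintegral_line hN)
    (ne_top_of_le_ne_top (ENNReal.mul_ne_top hC h2) (h N hN))
  filter_upwards [this] with p hp
  by_contra hc
  rw [not_lt, top_le_iff] at hc
  rw [hc, ENNReal.mul_top (mul_ne_zero (rayWeight_ne_zero _) (rayWeight_ne_zero _))] at hp
  exact lt_irrefl _ hp

theorem ae_integrable_line {F : Type*} [NormedAddCommGroup F] [MeasurableSpace F] [BorelSpace F]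
    [SecondCountableTopology F] {u : E3 → F} (hu : Measurable u) (h2 : MemLp u 2 volume) :
    ∀ᵐ p : E3 × E3, Integrable fun t : ℝ => u (p.1 + t • p.2) := by
  filter_upwards [ae_lintegral_line_lt_top hu.enorm (by rw [l2_enorm]; exact h2.2.ne)] with p hp
  have hm : Measurable fun t : ℝ => u (p.1 + t • p.2) := by fun_prop
  exact ⟨hm.aestronglyMeasurable, hp⟩

/-- A null set of points is met in a null set of times by almost every line. -/
theorem ae_ae_line {P : E3 → Prop} (hP : ∀ᵐ x, P x) :
    ∀ᵐ p : E3 × E3, ∀ᵐ t : ℝ, P (p.1 + t • p.2) := by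
  set S := toMeasurable volume {x | ¬ P x} with hS
  have hSm : MeasurableSet S := measurableSet_toMeasurable _ _
  have hS0 : volume S = 0 := by rw [measure_toMeasurable]; exact hP
  have hN : Measurable (S.indicator fun _ => (1 : ℝ≥0∞)) := measurable_const.indicator hSm
  have hl : l2 (S.indicator fun _ => (1 : ℝ≥0∞)) = 0 := by
    rw [l2, (lintegral_eq_zero_iff (by fun_prop)).2]
    · norm_num
    · have : ∀ᵐ x, x ∉ S := measure_eq_zero_iff_ae_notMem.1 hS0
      filter_upwards [this] with x hx
      simp [hx]
  obtain ⟨C, -, h⟩ := exists_bound_rayWeight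
  have h0 := h _ hN
  rw [hl, mul_zero, nonpos_iff_eq_zero, lintegral_eq_zero_iff
    (measurable_rayWeight_lintegral_line hN)] at h0
  filter_upwards [h0] with p hp
  have h1 : ∫⁻ t : ℝ, S.indicator (fun _ => (1 : ℝ≥0∞)) (p.1 + t • p.2) = 0 :=
    (mul_eq_zero.1 hp).resolve_left (mul_ne_zero (rayWeight_ne_zero _) (rayWeight_ne_zero _))
  rw [lintegral_eq_zero_iff (by fun_prop)] at h1
  filter_upwards [h1] with t ht
  by_contra hc
  have : p.1 + t • p.2 ∈ S := subset_toMeasurable _ _ hc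
  simp [this] at ht

theorem _root_.RayTransformVanishes.congr {u u' : TensorField} (h : RayTransformVanishes u)
    (hu : ∀ᵐ x, u x = u' x) : RayTransformVanishes u' := by
  filter_upwards [h, ae_ae_line hu] with p hp hline
  have : rayIntegrand u p.1 p.2 =ᵐ[volume] rayIntegrand u' p.1 p.2 := by
    filter_upwards [hline] with t ht
    simp only [rayIntegrand, ht]
  refine ⟨hp.1.congr this, ?_⟩
  rw [← hp.2, rayTransform, rayTransform, integral_congr_ae this]

/-- Every `L²` tensor field has a representative with measurable components. -/
theorem exists_measurable_rep {u : TensorField} (hu : ∀ j k, MemLp (fun x => u x j k) 2 volume) :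
    ∃ u' : TensorField, (∀ j k, Measurable fun x => u' x j k) ∧ ∀ᵐ x, u x = u' x := by
  refine ⟨fun x => Matrix.of fun j k => (hu j k).1.mk _ x, fun j k =>
    (hu j k).1.stronglyMeasurable_mk.measurable, ?_⟩
  have := ae_all_iff.2 fun j => ae_all_iff.2 fun k => (hu j k).1.ae_eq_mk
  filter_upwards [this] with x hx
  ext j k
  exact hx j k

theorem IsTensorFT.congr_left {u u' : TensorField} {F : E3 → Matrix (Fin 3) (Fin 3) ℂ}
    (hF : IsTensorFT u F) (h : ∀ᵐ x, u x = u' x) : IsTensorFT u' F := fun j k =>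
  (hF j k).congr (by filter_upwards [h] with y hy; rw [hy]) EventuallyEq.rfl

/-! ### Potential fields are in the kernel of the ray transform -/

/-- Differentiation along a line multiplies the Fourier transform by `2πi⟪ξ, y⟫`. -/
theorem hasDerivAt_fourierInv_line {s : E3 → ℂ} (hs : Integrable s volume)
    (hs' : Integrable (fun y => ‖y‖ * ‖s y‖) volume) (x ξ : E3) (t : ℝ) :
    HasDerivAt (fun t : ℝ => 𝓕⁻ s (x + t • ξ))
      (𝓕⁻ (fun y => (2 * Real.pi * Complex.I) * ((inner ℝ ξ y : ℝ) * s y)) (x + t • ξ)) t := by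
  have h1 := Real.hasFDerivAt_fourier hs hs' (-(x + t • ξ))
  have hc : HasDerivAt (fun t : ℝ => -(x + t • ξ)) (-ξ) t := by
    have := ((hasDerivAt_id t).smul_const ξ).const_add x
    simp only [one_smul, id_eq] at this
    exact this.neg
  have h2 := h1.comp_hasDerivAt t hc
  have e1 : (fun t : ℝ => 𝓕⁻ s (x + t • ξ)) = (𝓕 s) ∘ fun t : ℝ => -(x + t • ξ) := by
    ext t; simp [Real.fourierInv_eq_fourier_neg]
  rw [e1]
  convert! h2 using 1
  rw [Real.fourier_continuousLinearMap_apply, Real.fourierInv_eq_fourier_neg]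
  · refine congrArg (fun f : E3 → ℂ => 𝓕 f (-(x + t • ξ))) (funext fun y => ?_)
    simp only [VectorFourier.fourierSMulRight_apply]
    simp
    exact Or.inl (real_inner_comm _ _)
  · refine (hs'.const_mul (2 * Real.pi * ‖innerSL ℝ (E := E3)‖)).mono'
      hs.1.fourierSMulRight (Eventually.of_forall fun y => ?_)
    exact (VectorFourier.norm_fourierSMulRight_le _ _ _).trans (le_of_eq (by ring))

/-- A function whose Fourier transform is divisible by `⟪ξ, y⟫` has zero integral along lines in
the direction `ξ`: it is the derivative along the line of a function tending to zero. -/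
theorem integral_fourierInv_line_eq_zero {s : E3 → ℂ} (hs : Integrable s volume)
    (hs' : Integrable (fun y => ‖y‖ * ‖s y‖) volume) {x ξ : E3} (hξ : ξ ≠ 0)
    (hint : Integrable fun t : ℝ => 𝓕⁻ (fun y => ((inner ℝ ξ y : ℝ) : ℂ) * s y) (x + t • ξ)) :
    ∫ t : ℝ, 𝓕⁻ (fun y => ((inner ℝ ξ y : ℝ) : ℂ) * s y) (x + t • ξ) = 0 := by
  have hpi := Complex.two_pi_I_ne_zero
  let s' : E3 → ℂ := fun y => (2 * Real.pi * Complex.I)⁻¹ * s y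
  have h1 : Integrable s' volume := hs.const_mul _
  have h2 : Integrable (fun y => ‖y‖ * ‖s' y‖) volume := by
    refine (hs'.const_mul ‖(2 * Real.pi * Complex.I)⁻¹‖).congr (Eventually.of_forall fun y => ?_)
    simp only [s', norm_mul]; ring
  have e : (fun y => (2 * Real.pi * Complex.I) * (((inner ℝ ξ y : ℝ) : ℂ) * s' y)) =
      fun y => ((inner ℝ ξ y : ℝ) : ℂ) * s y := by
    ext y; simp only [s']; field_simp
  have hd : ∀ t : ℝ, HasDerivAt (fun t : ℝ => 𝓕⁻ s' (x + t • ξ))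
      (𝓕⁻ (fun y => ((inner ℝ ξ y : ℝ) : ℂ) * s y) (x + t • ξ)) t := by
    intro t
    have := hasDerivAt_fourierInv_line h1 h2 x ξ t
    rwa [e] at this
  have hline : Tendsto (fun t : ℝ => x + t • ξ) (cocompact ℝ) (cocompact E3) :=
    ((Homeomorph.addLeft x).isClosedEmbedding.comp
      (isClosedEmbedding_smul_left hξ)).tendsto_cocompact
  have hlim := (tendsto_fourierInv_cocompact s').comp hline
  rw [cocompact_eq_atBot_atTop, tendsto_sup] at hlim
  simpa using integral_of_hasDerivAt_of_tendsto hd hint hlim.1 hlim.2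

/-- The closed annulus of frequencies between `1/(n+1)` and `n+1`. -/
def annulus (n : ℕ) : Set E3 := {y | ((n : ℝ) + 1)⁻¹ ≤ ‖y‖ ∧ ‖y‖ ≤ n + 1}

theorem isCompact_annulus (n : ℕ) : IsCompact (annulus n) := by
  refine (isCompact_closedBall (0 : E3) ((n : ℝ) + 1)).of_isClosed_subset ?_ fun y hy => ?_
  · exact (isClosed_le continuous_const continuous_norm).inter
      (isClosed_le continuous_norm continuous_const)
  · simpa using hy.2

theorem ne_zero_of_mem_annulus {n : ℕ} {y : E3} (hy : y ∈ annulus n) : y ≠ 0 := by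
  rintro rfl
  have : (0 : ℝ) < ((n : ℝ) + 1)⁻¹ := by positivity
  have h := hy.1
  rw [norm_zero] at h
  linarith

theorem eventually_mem_annulus {y : E3} (hy : y ≠ 0) : ∀ᶠ n : ℕ in atTop, y ∈ annulus n := by
  have h1 : ∀ᶠ n : ℕ in atTop, ‖y‖ ≤ n :=
    tendsto_natCast_atTop_atTop.eventually_ge_atTop _
  have h2 : ∀ᶠ n : ℕ in atTop, ‖y‖⁻¹ ≤ n :=
    tendsto_natCast_atTop_atTop.eventually_ge_atTop _
  filter_upwards [h1, h2] with n hn1 hn2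
  refine ⟨?_, by linarith⟩
  rw [inv_le_comm₀ (by positivity) (norm_pos_iff.2 hy)]
  linarith

theorem tendsto_eLpNorm_sub_indicator_annulus {U : E3 → ℂ} (hU : MemLp U 2 volume) :
    Tendsto (fun n => eLpNorm (fun y => U y - (annulus n).indicator U y) 2 volume) atTop
      (𝓝 0) := by
  have hfin : ∫⁻ y, ‖U y‖ₑ ^ (2 : ℝ) ≠ ⊤ := by
    have := hU.2
    rw [← l2_enorm, l2] at this
    intro h
    rw [h] at this
    norm_num at this
  have hlim : Tendsto (fun n => ∫⁻ y, ‖U y - (annulus n).indicator U y‖ₑ ^ (2 : ℝ)) atTop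
      (𝓝 (∫⁻ _ : E3, 0)) := by
    refine tendsto_lintegral_of_dominated_convergence' (fun y => ‖U y‖ₑ ^ (2 : ℝ)) (fun n => ?_)
      (fun n => Eventually.of_forall fun y => ?_) hfin ?_
    · exact ((hU.1.sub (hU.1.indicator (isCompact_annulus n).measurableSet)).enorm).pow_const _
    · by_cases hy : y ∈ annulus n <;> simp [hy]
    · filter_upwards [Measure.ae_ne volume (0 : E3)] with y hy
      refine tendsto_const_nhds.congr' ?_
      filter_upwards [eventually_mem_annulus hy] with n hn
      simp [hn]
  rw [lintegral_zero] at hlim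
  have := (ENNReal.continuous_rpow_const (y := (1 / 2 : ℝ))).tendsto 0 |>.comp hlim
  simp only [Function.comp_def] at this
  rw [ENNReal.zero_rpow_of_pos (by norm_num)] at this
  refine this.congr fun n => ?_
  rw [← l2_enorm, l2]

theorem integrable_indicator_annulus_mul {U : E3 → ℂ} (hU : MemLp U 2 volume) (n : ℕ)
    {c : E3 → ℂ} (hc : ContinuousOn c (annulus n)) :
    Integrable ((annulus n).indicator fun y => U y * c y) volume := by
  rw [integrable_indicator_iff (isCompact_annulus n).measurableSet]
  exact ((hU.locallyIntegrable one_le_two).integrableOn_isCompact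
    (isCompact_annulus n)).mul_continuousOn hc (isCompact_annulus n)

/-- If the form `M` vanishes on the complement of `y ≠ 0`, then `M(ξ, ξ)` is divisible by
`⟪ξ, y⟫`. -/
theorem quadratic_eq_inner_mul {M : Matrix (Fin 3) (Fin 3) ℂ} {y : E3} (hy : y ≠ 0)
    (hM : ∀ w : E3, inner ℝ w y = 0 → ∑ j, ∑ k, M j k * w j * w k = 0) (ξ : E3) :
    ∑ j, ∑ k, M j k * (ξ j * ξ k) = ((inner ℝ ξ y : ℝ) : ℂ) *
      ∑ j, ∑ k, M j k * (((y j * ξ k + ξ j * y k) * (‖y‖ ^ 2)⁻¹ -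
        inner ℝ ξ y * (y j * y k) * ((‖y‖ ^ 2)⁻¹) ^ 2 : ℝ) : ℂ) := by
  have hn : ‖y‖ ^ 2 ≠ 0 := pow_ne_zero _ (norm_ne_zero_iff.2 hy)
  have h := hM (ξ - (inner ℝ ξ y * (‖y‖ ^ 2)⁻¹) • y) (by
    rw [inner_sub_left, real_inner_smul_left, real_inner_self_eq_norm_sq, mul_assoc,
      inv_mul_cancel₀ hn, mul_one, sub_self])
  rw [← sub_eq_zero, ← h, Finset.mul_sum, ← Finset.sum_sub_distrib]
  refine Finset.sum_congr rfl fun j _ => ?_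
  rw [Finset.mul_sum, ← Finset.sum_sub_distrib]
  refine Finset.sum_congr rfl fun k _ => ?_
  simp only [PiLp.sub_apply, PiLp.smul_apply, smul_eq_mul]
  push_cast
  ring

/-- If `U` vanishes on the complements of the frequencies, the field obtained by restricting `U` to
an annulus has ray transform zero. The restriction makes all the multipliers bounded. -/
theorem integral_line_fourierInv_quadratic {U : E3 → Matrix (Fin 3) (Fin 3) ℂ}
    (hU : ∀ j k, MemLp (fun y => U y j k) 2 volume) (hv : VanishesOnOrthogonal U) (n : ℕ)
    {x ξ : E3} (hξ : ξ ≠ 0)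
    (hint : ∀ j k, Integrable fun t : ℝ =>
      𝓕⁻ ((annulus n).indicator fun y => U y j k) (x + t • ξ)) :
    ∫ t : ℝ, ∑ j, ∑ k, 𝓕⁻ ((annulus n).indicator fun y => U y j k) (x + t • ξ) *
      ((ξ j : ℂ) * ξ k) = 0 := by
  let c : Fin 3 → Fin 3 → E3 → ℝ := fun j k y =>
    (y j * ξ k + ξ j * y k) * (‖y‖ ^ 2)⁻¹ - inner ℝ ξ y * (y j * y k) * ((‖y‖ ^ 2)⁻¹) ^ 2
  let s : E3 → ℂ := fun y =>
    ∑ j, ∑ k, (annulus n).indicator (fun y => U y j k * (c j k y : ℂ)) y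
  have hc : ∀ j k, ContinuousOn (fun y => (c j k y : ℂ)) (annulus n) := by
    intro j k
    refine Complex.continuous_ofReal.comp_continuousOn ?_
    have h0 : ∀ y ∈ annulus n, ‖y‖ ^ 2 ≠ 0 := fun y hy =>
      pow_ne_zero _ (norm_ne_zero_iff.2 (ne_zero_of_mem_annulus hy))
    have h1 : ContinuousOn (fun y : E3 => (‖y‖ ^ 2)⁻¹) (annulus n) :=
      ContinuousOn.inv₀ (by fun_prop) h0
    simp only [c]
    fun_prop
  have hs : Integrable s volume := integrable_finsetSum _ fun j _ => integrable_finsetSum _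
    fun k _ => integrable_indicator_annulus_mul (hU j k) n (hc j k)
  have hs' : Integrable (fun y => ‖y‖ * ‖s y‖) volume := by
    refine (hs.norm.const_mul ((n : ℝ) + 1)).mono' (by fun_prop) (Eventually.of_forall fun y => ?_)
    rw [Real.norm_of_nonneg (by positivity)]
    by_cases hy : y ∈ annulus n
    · gcongr
      exact hy.2
    · simp [s, hy]
  have hm : ∀ j k, Integrable ((annulus n).indicator fun y => U y j k) volume := fun j k => by
    simpa using integrable_indicator_annulus_mul (hU j k) n (c := 1) continuousOn_const
  have key : ∀ z : E3, ∑ j, ∑ k, 𝓕⁻ ((annulus n).indicator fun y => U y j k) z *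
      ((ξ j : ℂ) * ξ k) = 𝓕⁻ (fun y => ((inner ℝ ξ y : ℝ) : ℂ) * s y) z := by
    intro z
    have hi : ∀ j k, Integrable (fun y => Real.fourierChar (inner ℝ y z) •
        ((annulus n).indicator (fun y => U y j k) y) * ((ξ j : ℂ) * ξ k)) volume := by
      intro j k
      refine Integrable.mul_const ?_ _
      simpa using (Real.fourierIntegral_convergent_iff (-z)).2 (hm j k)
    simp only [Real.fourierInv_eq, ← integral_mul_const]
    rw [Finset.sum_congr rfl fun j _ => (integral_finsetSum _ fun k _ => hi j k).symm,
      ← integral_finsetSum _ fun j _ => integrable_finsetSum _ fun k _ => hi j k]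
    refine integral_congr_ae ?_
    filter_upwards [hv] with y hy
    by_cases hyn : y ∈ annulus n
    · have := quadratic_eq_inner_mul (ne_zero_of_mem_annulus hyn) hy ξ
      simp only [s, Set.indicator_of_mem hyn, smul_mul_assoc, ← Finset.smul_sum]
      rw [this]
    · simp [s, hyn]
  rw [integral_congr_ae (Eventually.of_forall fun t => key (x + t • ξ))]
  refine integral_fourierInv_line_eq_zero hs hs' hξ ?_
  simp only [← key]
  exact integrable_finsetSum _ fun j _ => integrable_finsetSum _ fun k _ => (hint j k).mul_const _

theorem ae_iInf_eq_zero_of_tendsto {X : Type*} [MeasurableSpace X] {μ : Measure X}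
    {g : ℕ → X → ℝ≥0∞} (hg : ∀ n, Measurable (g n))
    (hlim : Tendsto (fun n => ∫⁻ p, g n p ∂μ) atTop (𝓝 0)) : ∀ᵐ p ∂μ, ⨅ n, g n p = 0 := by
  have h0 : ∫⁻ p, ⨅ n, g n p ∂μ = 0 := le_antisymm
    (ge_of_tendsto' hlim fun n => lintegral_mono fun p => iInf_le _ n) zero_le
  exact (lintegral_eq_zero_iff (.iInf hg)).1 h0

theorem enorm_sum_mul_le (a : Matrix (Fin 3) (Fin 3) ℂ) (ξ : E3) :
    ‖∑ j, ∑ k, a j k * ((ξ j : ℂ) * ξ k)‖ₑ ≤ ‖ξ‖ₑ ^ 2 * ∑ j, ∑ k, ‖a j k‖ₑ := by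
  have hle : ∀ j, ‖(ξ j : ℂ)‖ₑ ≤ ‖ξ‖ₑ := fun j => by
    rw [enorm_le_iff_norm_le, Complex.norm_real]
    exact PiLp.norm_apply_le ξ j
  rw [Finset.mul_sum]
  refine (enorm_sum_le _ _).trans (Finset.sum_le_sum fun j _ => ?_)
  rw [Finset.mul_sum]
  refine (enorm_sum_le _ _).trans (Finset.sum_le_sum fun k _ => ?_)
  rw [enorm_mul, enorm_mul, mul_comm, sq]
  gcongr <;> exact hle _

/-- The fields with frequencies in an annulus have ray transform zero and converge in `L²`, hence
their ray transforms converge in a weighted `L¹` space of lines. -/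
theorem rayTransformVanishes_of_measurable {u : TensorField}
    {U : E3 → Matrix (Fin 3) (Fin 3) ℂ} (hm : ∀ j k, Measurable fun x => u x j k)
    (hU : IsTensorFT u U) (hv : VanishesOnOrthogonal U) : RayTransformVanishes u := by
  let m : ℕ → Fin 3 → Fin 3 → E3 → ℂ := fun n j k => (annulus n).indicator fun y => U y j k
  have hm1 : ∀ n j k, Integrable (m n j k) volume := fun n j k => by
    simpa using integrable_indicator_annulus_mul (hU j k).2 n (c := 1) continuousOn_const
  have hm2 : ∀ n j k, MemLp (m n j k) 2 volume := fun n j k =>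
    (hU j k).2.indicator (isCompact_annulus n).measurableSet
  have hp : ∀ n j k, IsFourierPair (𝓕⁻ (m n j k)) (m n j k) := fun n j k =>
    isFourierPair_fourierInv (hm1 n j k) (hm2 n j k)
  have hmeas : ∀ n j k, Measurable (𝓕⁻ (m n j k)) := fun n j k =>
    (continuous_fourierInv (hm1 n j k)).measurable
  have humeas : ∀ j k, Measurable fun x => (u x j k : ℂ) := fun j k => by
    have := hm j k
    fun_prop
  let N : ℕ → Fin 3 → Fin 3 → E3 → ℝ≥0∞ := fun n j k x => ‖(u x j k : ℂ) - 𝓕⁻ (m n j k) x‖ₑ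
  have hN : ∀ n j k, Measurable (N n j k) := fun n j k =>
    ((humeas j k).sub (hmeas n j k)).enorm
  have hNl : ∀ n j k, l2 (N n j k) =
      eLpNorm (fun y => U y j k - (annulus n).indicator (fun y => U y j k) y) 2 volume := by
    intro n j k
    rw [← ((hU j k).sub (hp n j k)).eLpNorm_eq, ← l2_enorm]
  let g : ℕ → E3 × E3 → ℝ≥0∞ := fun n p => ∑ j, ∑ k,
    rayWeight p.1 * rayWeight p.2 * ∫⁻ t : ℝ, N n j k (p.1 + t • p.2)
  have hg : ∀ n, Measurable (g n) := fun n => Finset.measurable_fun_sum _ fun j _ =>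
    Finset.measurable_fun_sum _ fun k _ => measurable_rayWeight_lintegral_line (hN n j k)
  obtain ⟨C, hC, hbound⟩ := exists_bound_rayWeight
  have hlim : Tendsto (fun n => ∫⁻ p, g n p) atTop (𝓝 0) := by
    have h1 : Tendsto (fun n => ∑ j : Fin 3, ∑ k : Fin 3, C * l2 (N n j k)) atTop (𝓝 0) := by
      have : (0 : ℝ≥0∞) = ∑ j : Fin 3, ∑ k : Fin 3, C * 0 := by simp
      rw [this]
      refine tendsto_finsetSum _ fun j _ => tendsto_finsetSum _ fun k _ =>
        ENNReal.Tendsto.const_mul ?_ (Or.inr hC)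
      simp only [hNl]
      exact tendsto_eLpNorm_sub_indicator_annulus (hU j k).2
    refine tendsto_of_tendsto_of_tendsto_of_le_of_le tendsto_const_nhds h1
      (fun n => zero_le) fun n => ?_
    simp only [g]
    rw [lintegral_finsetSum _ fun j _ => Finset.measurable_fun_sum _ fun k _ =>
      measurable_rayWeight_lintegral_line (hN n j k)]
    refine Finset.sum_le_sum fun j _ => ?_
    rw [lintegral_finsetSum _ fun k _ => measurable_rayWeight_lintegral_line (hN n j k)]
    exact Finset.sum_le_sum fun k _ => hbound _ (hN n j k)
  have hui := ae_all_iff.2 fun j => ae_all_iff.2 fun k =>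
    ae_integrable_line (humeas j k) (hU j k).1
  have hni := ae_all_iff.2 fun n => ae_all_iff.2 fun j => ae_all_iff.2 fun k =>
    ae_integrable_line (hmeas n j k) (hp n j k).1
  have hξ : ∀ᵐ p : E3 × E3, p.2 ≠ 0 :=
    Measure.quasiMeasurePreserving_snd.ae (Measure.ae_ne volume (0 : E3))
  filter_upwards [ae_iInf_eq_zero_of_tendsto hg hlim, hui, hni, hξ] with p hp0 hui hni hξ
  have hint : Integrable fun t : ℝ => ∑ j, ∑ k, (u (p.1 + t • p.2) j k : ℂ) *
      ((p.2 j : ℂ) * p.2 k) := integrable_finsetSum _ fun j _ => integrable_finsetSum _ fun k _ =>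
    (hui j k).mul_const _
  have hre : ∀ t, ∑ j, ∑ k, (u (p.1 + t • p.2) j k : ℂ) * ((p.2 j : ℂ) * p.2 k) =
      (rayIntegrand u p.1 p.2 t : ℂ) := fun t => by
    rw [rayIntegrand]; push_cast; simp only [mul_assoc]
  simp only [hre] at hint
  refine ⟨by simpa using hint.re, ?_⟩
  have hle : ∀ n, rayWeight p.1 * rayWeight p.2 * ‖rayTransform u p.1 p.2‖ₑ ≤
      ‖p.2‖ₑ ^ 2 * g n p := by
    intro n
    have h1 := integral_line_fourierInv_quadratic (fun j k => (hU j k).2) hv n (x := p.1) hξ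
      (hni n)
    have h2 : (rayTransform u p.1 p.2 : ℂ) = ∫ t : ℝ, ∑ j, ∑ k,
        ((u (p.1 + t • p.2) j k : ℂ) - 𝓕⁻ (m n j k) (p.1 + t • p.2)) *
          ((p.2 j : ℂ) * p.2 k) := by
      rw [rayTransform, ← integral_complex_ofReal, ← sub_zero (∫ t : ℝ, _), ← h1,
        ← integral_sub hint (integrable_finsetSum _ fun j _ => integrable_finsetSum _ fun k _ =>
          (hni n j k).mul_const _)]
      refine integral_congr_ae (Eventually.of_forall fun t => ?_)
      simp only [← hre, ← Finset.sum_sub_distrib, sub_mul, m]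
    have h3 : ‖rayTransform u p.1 p.2‖ₑ ≤
        ‖p.2‖ₑ ^ 2 * ∑ j, ∑ k, ∫⁻ t : ℝ, N n j k (p.1 + t • p.2) := by
      have h4 : ‖rayTransform u p.1 p.2‖ₑ = ‖(rayTransform u p.1 p.2 : ℂ)‖ₑ := by
        rw [enorm_eq_iff_norm_eq, Complex.norm_real]
      have hmt : ∀ j k, Measurable fun t : ℝ => N n j k (p.1 + t • p.2) := fun j k =>
        (hN n j k).comp (by fun_prop)
      rw [h4, h2]
      refine (enorm_integral_le_lintegral_enorm _).trans ((lintegral_mono fun t =>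
        enorm_sum_mul_le (Matrix.of fun j k =>
          (u (p.1 + t • p.2) j k : ℂ) - 𝓕⁻ (m n j k) (p.1 + t • p.2)) p.2).trans ?_)
      simp only [Matrix.of_apply]
      rw [lintegral_const_mul _ (Finset.measurable_fun_sum _ fun j _ =>
        Finset.measurable_fun_sum _ fun k _ => hmt j k),
        lintegral_finsetSum _ fun j _ => Finset.measurable_fun_sum _ fun k _ => hmt j k,
        Finset.sum_congr rfl fun j _ => lintegral_finsetSum _ fun k _ => hmt j k]
    refine (mul_le_mul_right h3 _).trans (le_of_eq ?_)
    simp only [g, ← Finset.mul_sum]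
    ring
  have h5 : rayWeight p.1 * rayWeight p.2 * ‖rayTransform u p.1 p.2‖ₑ ≤ 0 := by
    refine (le_iInf hle).trans (le_of_eq ?_)
    rw [← ENNReal.mul_iInf_of_ne (by simpa using hξ) (by simp), hp0, mul_zero]
  have h6 := nonpos_iff_eq_zero.1 h5
  simpa [rayWeight_ne_zero] using h6

/-- An `L²` tensor field whose Fourier transform at `y` vanishes on the complement of `y` lies in
the kernel of the ray transform. -/
theorem rayTransformVanishes_of_vanishesOnOrthogonal {u : TensorField}
    {U : E3 → Matrix (Fin 3) (Fin 3) ℂ} (hU : IsTensorFT u U) (hv : VanishesOnOrthogonal U) :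
    RayTransformVanishes u := by
  obtain ⟨u', hm, hu⟩ := exists_measurable_rep (u := u) fun j k => by
    simpa using (hU j k).1.re
  exact RayTransformVanishes.congr (rayTransformVanishes_of_measurable hm (hU.congr_left hu) hv)
    (hu.mono fun _ h => h.symm)

/-! ### Pairings with line integrals on the Fourier side -/

theorem fourierInv_compSubConstCLM_apply (ψ : 𝓢(E3, ℂ)) (a y : E3) :
    𝓕⁻ (ψ.compSubConstCLM ℂ a) y = Real.fourierChar (inner ℝ a y) • 𝓕⁻ ψ y := by
  rw [fourierInv_coe, fourierInv_coe, Real.fourierInv_eq, Real.fourierInv_eq,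
    ← integral_add_right_eq_self _ a, Circle.smul_def, ← integral_smul]
  refine integral_congr_ae (Eventually.of_forall fun x => ?_)
  simp only [compSubConstCLM_apply, add_sub_cancel_right, inner_add_left, AddChar.map_add_eq_mul]
  simp only [Circle.smul_def, Circle.coe_mul, smul_eq_mul]
  ring

/-- Translation of `u` multiplies its transform by a character. -/
theorem IsFourierPair.pairing_translate {u U : E3 → ℂ} (h : IsFourierPair u U)
    (ψ : 𝓢(E3, ℂ)) (a : E3) :
    ∫ x, ψ x * u (x + a) = ∫ y, (Real.fourierChar (inner ℝ a y) : ℂ) * (𝓕⁻ ψ y * U y) := by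
  rw [← integral_sub_right_eq_self _ a]
  have := h.pairing_inv (ψ.compSubConstCLM ℂ a)
  simp only [fourierInv_compSubConstCLM_apply, compSubConstCLM_apply, Circle.smul_def, smul_eq_mul,
    mul_assoc] at this
  simpa using this

/-- For a fixed time `t`, averaging `u` over the points `x + t ξ` multiplies its transform by the
value at `t y` of the weight in the frequency variable. -/
theorem IsFourierPair.pairing_line {u U : E3 → ℂ} (h : IsFourierPair u U)
    (ψ κ : 𝓢(E3, ℂ)) (t : ℝ) :
    ∫ ξ, ∫ x, ψ x * κ ξ * u (x + t • ξ) = ∫ y, 𝓕⁻ ψ y * U y * 𝓕⁻ κ (t • y) := by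
  have h1 : ∀ ξ, ∫ x, ψ x * κ ξ * u (x + t • ξ) =
      ∫ y, (Real.fourierChar (inner ℝ (t • ξ) y) : ℂ) * (κ ξ * (𝓕⁻ ψ y * U y)) := by
    intro ξ
    have := congrArg (κ ξ * ·) (h.pairing_translate ψ (t • ξ))
    simp only [← integral_const_mul] at this
    calc ∫ x, ψ x * κ ξ * u (x + t • ξ) = ∫ x, κ ξ * (ψ x * u (x + t • ξ)) := by
          simp only [mul_left_comm (κ ξ), mul_assoc]
      _ = _ := by rw [this]; simp only [mul_left_comm (κ ξ)]
  simp only [h1]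
  rw [integral_integral_swap]
  · refine integral_congr_ae (Eventually.of_forall fun y => ?_)
    simp only
    rw [fourierInv_coe κ, Real.fourierInv_eq, ← integral_const_mul]
    refine integral_congr_ae (Eventually.of_forall fun ξ => ?_)
    simp only [Circle.smul_def, smul_eq_mul, real_inner_smul_left, real_inner_smul_right]
    ring
  · refine Integrable.bdd_mul (c := 1)
      (κ.integrable.mul_prod (integrable_schwartz_mul (𝓕⁻ ψ) h.2)) ?_
      (Eventually.of_forall fun q => (Circle.norm_coe _).le)
    have : Continuous fun q : E3 × E3 => (Real.fourierChar (inner ℝ (t • q.1) q.2) : ℂ) :=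
      continuous_subtype_val.comp (Real.continuous_fourierChar.comp (by fun_prop))
    exact this.aestronglyMeasurable

theorem l2_enorm_schwartz_ne_top (θ : 𝓢(E3, ℂ)) : l2 (fun x => ‖θ x‖ₑ) ≠ ⊤ := by
  have := (θ.memLp 2 (volume : Measure E3)).eLpNorm_ne_top
  rwa [← l2_enorm] at this

theorem lintegral_enorm_schwartz_ne_top (θ : 𝓢(E3, ℂ)) : ∫⁻ x, ‖θ x‖ₑ ≠ ⊤ :=
  θ.integrable.2.ne

theorem exists_enorm_schwartz_le (θ : 𝓢(E3, ℂ)) : ∃ a : ℝ≥0∞, a ≠ ⊤ ∧ ∀ x, ‖θ x‖ₑ ≤ a := by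
  refine ⟨ENNReal.ofReal (SchwartzMap.seminorm ℝ 0 0 θ), ENNReal.ofReal_ne_top, fun x => ?_⟩
  rw [← ofReal_norm]
  exact ENNReal.ofReal_le_ofReal (norm_le_seminorm ℝ θ x)

theorem integrable_ray_schwartz {u : E3 → ℂ} (hu : Measurable u) (hu2 : MemLp u 2 volume)
    (ψ κ : 𝓢(E3, ℂ)) :
    Integrable (fun q : (E3 × E3) × ℝ => ψ q.1.1 * κ q.1.2 * u (q.1.1 + q.2 • q.1.2))
      (volume.prod volume) := by
  have hψ := ψ.continuous.measurable
  have hκ := κ.continuous.measurable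
  refine ⟨by fun_prop, ?_⟩
  obtain ⟨C, hC, hb⟩ := exists_bound_ray_prod hψ.enorm hκ.enorm
    (lintegral_enorm_schwartz_ne_top ψ) (lintegral_enorm_schwartz_ne_top κ)
    (l2_enorm_schwartz_ne_top ψ) (l2_enorm_schwartz_ne_top κ)
  have h1 := hb _ hu.enorm
  rw [l2_enorm] at h1
  rw [HasFiniteIntegral, lintegral_prod _ (by fun_prop)]
  simp only [enorm_mul]
  exact h1.trans_lt (ENNReal.mul_lt_top hC.lt_top hu2.2)

theorem integrable_ray_origin_schwartz {U : E3 → ℂ} (hU : Measurable U) (hU2 : MemLp U 2 volume)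
    (P G : 𝓢(E3, ℂ)) :
    Integrable (fun q : ℝ × E3 => P q.2 * U q.2 * G (q.1 • q.2)) (volume.prod volume) := by
  have hP := P.continuous.measurable
  have hG := G.continuous.measurable
  refine ⟨by fun_prop, ?_⟩
  obtain ⟨a, ha, hPa⟩ := exists_enorm_schwartz_le P
  obtain ⟨b, hb, hGb⟩ := exists_enorm_schwartz_le G
  have h1 := lintegral_ray_origin_ne_top hP.enorm hU.enorm hG.enorm ha hb hPa hGb
    (l2_enorm_schwartz_ne_top P) (by rw [l2_enorm]; exact hU2.2.ne) (l2_enorm_schwartz_ne_top G)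
  rw [HasFiniteIntegral, lintegral_prod _ (by fun_prop)]
  simp only [enorm_mul]
  exact h1.lt_top

theorem integrable_schwartz_mul_integral_line {u : E3 → ℂ} (hu : Measurable u)
    (hu2 : MemLp u 2 volume) (ψ κ : 𝓢(E3, ℂ)) :
    Integrable fun p : E3 × E3 => ψ p.1 * κ p.2 * ∫ t : ℝ, u (p.1 + t • p.2) := by
  have := (integrable_ray_schwartz hu hu2 ψ κ).integral_prod_left
  simpa only [integral_const_mul] using this

theorem integrable_schwartz_mul_integral_ray {U : E3 → ℂ} (hU : Measurable U)
    (hU2 : MemLp U 2 volume) (P G : 𝓢(E3, ℂ)) :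
    Integrable fun y : E3 => P y * U y * ∫ t : ℝ, G (t • y) := by
  have := (integrable_ray_origin_schwartz hU hU2 P G).integral_prod_right
  simpa only [integral_const_mul] using this

/-- The line integrals of `u`, averaged over the base point `x` and the direction `ξ` with Schwartz
weights, in terms of the transform `U` and of the integrals of the weight along the frequency lines
`t ↦ t y`. -/
theorem IsFourierPair.integral_pairing_line {u U : E3 → ℂ} (h : IsFourierPair u U)
    (hu : Measurable u) (hU : Measurable U) (ψ κ : 𝓢(E3, ℂ)) :
    ∫ p : E3 × E3, ψ p.1 * κ p.2 * ∫ t : ℝ, u (p.1 + t • p.2) =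
      ∫ y, 𝓕⁻ ψ y * U y * ∫ t : ℝ, 𝓕⁻ κ (t • y) := by
  have h1 := integrable_ray_schwartz hu h.1 ψ κ
  have h2 := integrable_ray_origin_schwartz hU h.2 (𝓕⁻ ψ) (𝓕⁻ κ)
  simp only [← integral_const_mul]
  rw [integral_integral_swap h1, integral_integral_swap
    (f := fun y t => 𝓕⁻ ψ y * U y * 𝓕⁻ κ (t • y)) h2.swap]
  refine integral_congr_ae ?_
  filter_upwards [h1.swap.prod_right_ae] with t ht
  rw [← h.pairing_line, Measure.volume_eq_prod]
  exact integral_prod_symm (fun p : E3 × E3 => ψ p.1 * κ p.2 * u (p.1 + t • p.2)) ht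

/-! ### Ellipsoidal test functions -/

/-- A smooth decreasing cutoff, equal to one on `s ≤ 1` and to zero on `s ≥ 2`. -/
noncomputable def cutoff (s : ℝ) : ℝ := Real.smoothTransition (2 - s)

theorem contDiff_cutoff : ContDiff ℝ ∞ cutoff :=
  Real.smoothTransition.contDiff.comp (contDiff_const.sub contDiff_id)

theorem contDiff_deriv_cutoff : ContDiff ℝ ∞ (deriv cutoff) :=
  (contDiff_infty_iff_deriv.1 contDiff_cutoff).2

theorem hasDerivAt_cutoff (s : ℝ) : HasDerivAt cutoff (deriv cutoff s) s :=
  (contDiff_cutoff.differentiable (by simp) s).hasDerivAt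

theorem hasDerivAt_deriv_cutoff (s : ℝ) :
    HasDerivAt (deriv cutoff) (deriv (deriv cutoff) s) s :=
  (contDiff_deriv_cutoff.differentiable (by simp) s).hasDerivAt

theorem cutoff_of_two_le {s : ℝ} (hs : 2 ≤ s) : cutoff s = 0 :=
  Real.smoothTransition.zero_of_nonpos (by linarith)

theorem antitone_cutoff : Antitone cutoff := fun _ _ h =>
  Real.smoothTransition.monotone (by linarith)

theorem deriv_cutoff_of_two_lt {s : ℝ} (hs : 2 < s) : deriv cutoff s = 0 := by
  have : cutoff =ᶠ[𝓝 s] fun _ => 0 := by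
    filter_upwards [lt_mem_nhds hs] with r hr using cutoff_of_two_le hr.le
  rw [this.deriv_eq, deriv_const]

theorem deriv_deriv_cutoff_of_two_lt {s : ℝ} (hs : 2 < s) : deriv (deriv cutoff) s = 0 := by
  have : deriv cutoff =ᶠ[𝓝 s] fun _ => 0 := by
    filter_upwards [lt_mem_nhds hs] with r hr using deriv_cutoff_of_two_lt hr
  rw [this.deriv_eq, deriv_const]

theorem hasCompactSupport_comp_sq_mul {F : ℝ → ℝ} (hF : ∀ s, 2 < s → F s = 0) {q : ℝ}
    (hq : 0 < q) : HasCompactSupport fun t : ℝ => F (t ^ 2 * q) := by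
  refine HasCompactSupport.of_support_subset_isCompact
    (isCompact_closedBall (0 : ℝ) (2 / q + 1)) fun t ht => ?_
  by_contra hc
  rw [mem_closedBall_zero_iff, Real.norm_eq_abs, not_le] at hc
  refine ht (hF _ ?_)
  have h1 : 0 < 2 / q := by positivity
  have h2 : 2 / q < t ^ 2 := by
    rw [← sq_abs]
    nlinarith
  rwa [div_lt_iff₀ hq] at h2

/-- The constant `∫ h'(t² q) dt` for the cutoff `h`. -/
noncomputable def cutoffConst (q : ℝ) : ℝ := ∫ t : ℝ, deriv cutoff (t ^ 2 * q)

theorem cutoffConst_ne_zero {q : ℝ} (hq : 0 < q) : cutoffConst q ≠ 0 := by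
  -- if it were zero, the nonpositive function `h'` would vanish and `h` be constant for `s ≥ 0`
  have hcont : Continuous fun t : ℝ => -deriv cutoff (t ^ 2 * q) :=
    (contDiff_deriv_cutoff.continuous.comp (by fun_prop)).neg
  have hc : HasCompactSupport fun t : ℝ => -deriv cutoff (t ^ 2 * q) :=
    hasCompactSupport_comp_sq_mul (F := fun s => -deriv cutoff s)
      (fun s hs => by rw [deriv_cutoff_of_two_lt hs, neg_zero]) hq
  obtain ⟨t₀, ht₀⟩ : ∃ t : ℝ, deriv cutoff (t ^ 2 * q) ≠ 0 := by
    by_contra! h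
    have hd : ∀ t : ℝ, HasDerivAt (fun t : ℝ => cutoff (t ^ 2 * q)) 0 t := fun t => by
      have := (hasDerivAt_cutoff (t ^ 2 * q)).comp t ((hasDerivAt_pow 2 t).mul_const q)
      rwa [h t, zero_mul] at this
    have := is_const_of_deriv_eq_zero (fun t => (hd t).differentiableAt) (fun t => (hd t).deriv)
      0 (√(2 / q))
    have h2 : (√(2 / q)) ^ 2 * q = 2 := by
      rw [Real.sq_sqrt (by positivity)]; field_simp
    simp only [h2, cutoff_of_two_le le_rfl] at this
    simp [cutoff, Real.smoothTransition.one_of_one_le] at this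
  have := hcont.integral_pos_of_hasCompactSupport_nonneg_nonzero (μ := volume) hc
    (fun t => neg_nonneg.2 antitone_cutoff.deriv_nonpos) (neg_ne_zero.2 ht₀)
  rw [integral_neg] at this
  rw [cutoffConst]
  linarith

/-- The second formula is an integration by parts: the derivative of `t h'(t² q)` has integral
zero. -/
theorem integral_sq_mul_deriv_deriv_cutoff {q : ℝ} (hq : 0 < q) :
    Integrable (fun t : ℝ => t ^ 2 * deriv (deriv cutoff) (t ^ 2 * q)) ∧
      ∫ t : ℝ, t ^ 2 * deriv (deriv cutoff) (t ^ 2 * q) = -(cutoffConst q / (2 * q)) := by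
  have hc1 := hasCompactSupport_comp_sq_mul (fun s hs => deriv_cutoff_of_two_lt hs) hq
  have hc2 := hasCompactSupport_comp_sq_mul (fun s hs => deriv_deriv_cutoff_of_two_lt hs) hq
  have hcont1 : Continuous fun t : ℝ => deriv cutoff (t ^ 2 * q) :=
    contDiff_deriv_cutoff.continuous.comp (by fun_prop)
  have hcont2 : Continuous fun t : ℝ => deriv (deriv cutoff) (t ^ 2 * q) :=
    ((contDiff_infty_iff_deriv.1 contDiff_deriv_cutoff).2.continuous).comp (by fun_prop)
  have hi1 := hcont1.integrable_of_hasCompactSupport hc1 (μ := volume)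
  have hi2 : Integrable (fun t : ℝ => t ^ 2 * deriv (deriv cutoff) (t ^ 2 * q)) :=
    ((continuous_pow 2).mul hcont2).integrable_of_hasCompactSupport
    (hc2.mul_left (f := fun t : ℝ => t ^ 2))
  refine ⟨hi2, ?_⟩
  have hd : ∀ t : ℝ, HasDerivAt (fun t : ℝ => t * deriv cutoff (t ^ 2 * q))
      (deriv cutoff (t ^ 2 * q) + 2 * q * (t ^ 2 * deriv (deriv cutoff) (t ^ 2 * q))) t := by
    intro t
    have := (hasDerivAt_deriv_cutoff (t ^ 2 * q)).comp t ((hasDerivAt_pow 2 t).mul_const q)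
    refine ((hasDerivAt_id t).mul this).congr_deriv ?_
    simp; ring
  have hlim : Tendsto (fun t : ℝ => t * deriv cutoff (t ^ 2 * q)) (cocompact ℝ) (𝓝 0) :=
    (hc1.mul_left (f := fun t : ℝ => t)).is_zero_at_infty
  rw [cocompact_eq_atBot_atTop, tendsto_sup] at hlim
  have := integral_of_hasDerivAt_of_tendsto hd (hi1.add (hi2.const_mul (2 * q))) hlim.1 hlim.2
  rw [integral_add hi1 (hi2.const_mul (2 * q)), integral_const_mul, sub_zero] at this
  rw [← cutoffConst] at this
  field_simp
  linarith

/-- The linear map `x ↦ x + ⟪b, x⟫ b`. -/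
noncomputable def stretch (b x : E3) : E3 := x + (inner ℝ b x : ℝ) • b

/-- The quadratic form `‖x‖² + ⟪b, x⟫²` of the map `stretch b`. -/
noncomputable def stretchForm (b x : E3) : ℝ := ‖x‖ ^ 2 + inner ℝ b x ^ 2

theorem stretchForm_pos (b : E3) {x : E3} (hx : x ≠ 0) : 0 < stretchForm b x := by
  have := norm_pos_iff.2 hx
  unfold stretchForm
  positivity

theorem contDiff_stretchForm (b : E3) : ContDiff ℝ ∞ (stretchForm b) :=
  (contDiff_norm_sq ℝ).add ((contDiff_const.inner ℝ contDiff_id).pow 2)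

theorem hasFDerivAt_stretchForm (b x : E3) :
    HasFDerivAt (stretchForm b) ((2 : ℝ) • innerSL ℝ (stretch b x)) x := by
  have h1 := (hasStrictFDerivAt_norm_sq x).hasFDerivAt
  have h2 := ((innerSL ℝ b).hasFDerivAt (x := x)).pow 2
  refine (h1.add h2).congr_fderiv ?_
  ext m
  simp [stretch]
  ring

theorem contDiff_cutoff_stretchForm (b : E3) : ContDiff ℝ ∞ fun x => cutoff (stretchForm b x) :=
  contDiff_cutoff.comp (contDiff_stretchForm b)

theorem hasCompactSupport_cutoff_stretchForm (b : E3) :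
    HasCompactSupport fun x => (cutoff (stretchForm b x) : ℂ) := by
  refine HasCompactSupport.of_support_subset_isCompact
    (isCompact_closedBall (0 : E3) 2) fun x hx => ?_
  by_contra hc
  rw [mem_closedBall_zero_iff, not_le] at hc
  refine hx ?_
  simp only [Complex.ofReal_eq_zero]
  refine cutoff_of_two_le ?_
  unfold stretchForm
  nlinarith [sq_nonneg (inner ℝ b x : ℝ)]

/-- The test function `h(‖x‖² + ⟪b, x⟫²)`. -/
noncomputable def ellipsoidTest (b : E3) : 𝓢(E3, ℂ) :=
  (hasCompactSupport_cutoff_stretchForm b).toSchwartzMap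
    (Complex.ofRealCLM.contDiff.comp (contDiff_cutoff_stretchForm b))

theorem hasFDerivAt_cutoff_stretchForm (b x : E3) :
    HasFDerivAt (fun x => cutoff (stretchForm b x))
      (deriv cutoff (stretchForm b x) • (2 : ℝ) • innerSL ℝ (stretch b x)) x :=
  (hasDerivAt_cutoff _).comp_hasFDerivAt x (hasFDerivAt_stretchForm b x)

theorem lineDerivOp_ellipsoidTest (b l x : E3) : (∂_{l} (ellipsoidTest b) : 𝓢(E3, ℂ)) x =
    ((deriv cutoff (stretchForm b x) * (2 * inner ℝ (stretch b x) l) : ℝ) : ℂ) := by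
  rw [lineDerivOp_apply_ofReal (contDiff_cutoff_stretchForm b) (φ := ellipsoidTest b)
    (fun _ => rfl), (hasFDerivAt_cutoff_stretchForm b x).fderiv]
  simp

theorem lineDerivOp_lineDerivOp_ellipsoidTest (b m l x : E3) :
    (∂_{m} (∂_{l} (ellipsoidTest b)) : 𝓢(E3, ℂ)) x =
      ((4 * deriv (deriv cutoff) (stretchForm b x) * inner ℝ (stretch b x) m *
        inner ℝ (stretch b x) l +
        2 * deriv cutoff (stretchForm b x) * inner ℝ (stretch b m) l : ℝ) : ℂ) := by
  have hs : ContDiff ℝ ∞ (stretch b) :=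
    contDiff_id.add ((contDiff_const.inner ℝ contDiff_id).smul contDiff_const)
  have hsm : HasFDerivAt (fun x => (inner ℝ (stretch b x) l : ℝ))
      (innerSL ℝ l + (inner ℝ b l : ℝ) • innerSL ℝ b) x := by
    have := ((innerSL ℝ l).hasFDerivAt (x := x)).add
      (((innerSL ℝ b).hasFDerivAt (x := x)).const_mul (inner ℝ b l))
    refine this.congr_of_eventuallyEq (Eventually.of_forall fun z => ?_)
    simp [stretch, inner_add_left, real_inner_smul_left, real_inner_comm l z, mul_comm]
  have h1 := (hasDerivAt_deriv_cutoff _).comp_hasFDerivAt x (hasFDerivAt_stretchForm b x)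
  have h2 : HasFDerivAt (fun x => deriv cutoff (stretchForm b x) *
      (2 * inner ℝ (stretch b x) l)) _ x := h1.mul (hsm.const_mul 2)
  rw [lineDerivOp_apply_ofReal ?_ (lineDerivOp_ellipsoidTest b l)]
  · rw [h2.fderiv]
    congr 1
    simp [stretch, inner_add_left, real_inner_smul_left, real_inner_comm l m]
    ring
  · exact (contDiff_deriv_cutoff.comp (contDiff_stretchForm b)).mul
      (contDiff_const.mul (hs.inner ℝ contDiff_const))

theorem stretch_smul (b x : E3) (t : ℝ) : stretch b (t • x) = t • stretch b x := by
  simp [stretch, real_inner_smul_right, smul_add, smul_smul]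

theorem stretchForm_smul (b x : E3) (t : ℝ) : stretchForm b (t • x) = t ^ 2 * stretchForm b x := by
  simp only [stretchForm, real_inner_smul_right, norm_smul, mul_pow, Real.norm_eq_abs, sq_abs]
  ring

/-- The integrals along rays of the second derivatives of the ellipsoidal test function. -/
theorem integral_lineDerivOp_ellipsoidTest (b m l : E3) {y : E3} (hy : y ≠ 0) :
    ∫ t : ℝ, (∂_{m} (∂_{l} (ellipsoidTest b)) : 𝓢(E3, ℂ)) (t • y) =
      ((2 * cutoffConst (stretchForm b y) * (inner ℝ (stretch b m) l -
        inner ℝ (stretch b y) m * inner ℝ (stretch b y) l / stretchForm b y) : ℝ) : ℂ) := by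
  have hq := stretchForm_pos b hy
  obtain ⟨hi, hint⟩ := integral_sq_mul_deriv_deriv_cutoff hq
  have hi1 : Integrable fun t : ℝ => deriv cutoff (t ^ 2 * stretchForm b y) :=
    (contDiff_deriv_cutoff.continuous.comp (by fun_prop)).integrable_of_hasCompactSupport
      (hasCompactSupport_comp_sq_mul (fun s hs => deriv_cutoff_of_two_lt hs) hq)
  simp only [lineDerivOp_lineDerivOp_ellipsoidTest, stretch_smul, stretchForm_smul,
    real_inner_smul_left]
  rw [integral_complex_ofReal]
  congr 1
  have e : ∀ t : ℝ, 4 * deriv (deriv cutoff) (t ^ 2 * stretchForm b y) *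
      (t * inner ℝ (stretch b y) m) * (t * inner ℝ (stretch b y) l) +
      2 * deriv cutoff (t ^ 2 * stretchForm b y) * inner ℝ (stretch b m) l =
      (4 * inner ℝ (stretch b y) m * inner ℝ (stretch b y) l) *
        (t ^ 2 * deriv (deriv cutoff) (t ^ 2 * stretchForm b y)) +
      (2 * inner ℝ (stretch b m) l) * deriv cutoff (t ^ 2 * stretchForm b y) := fun t => by ring
  simp only [e]
  rw [integral_add (hi.const_mul _) (hi1.const_mul _), integral_const_mul, integral_const_mul,
    hint]
  change _ + _ * cutoffConst _ = _
  field_simp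
  ring

/-! ### The kernel of the ray transform consists of potential fields -/

/-- Local integrability is a consequence of the integrability of all the products. -/
theorem ae_eq_zero_of_integrable_schwartz_mul {M : E3 → ℂ}
    (hi : ∀ θ : 𝓢(E3, ℂ), Integrable fun y => θ y * M y)
    (h : ∀ θ : 𝓢(E3, ℂ), ∫ y, θ y * M y = 0) : M =ᵐ[volume] 0 := by
  refine ae_eq_zero_of_schwartz (fun x => ?_) h
  let χ : ContDiffBump x := ⟨1, 2, one_pos, one_lt_two⟩
  have c1 : HasCompactSupport fun y => ((χ y : ℝ) : ℂ) :=
    χ.hasCompactSupport.comp_left (g := ((↑) : ℝ → ℂ)) rfl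
  refine ⟨Metric.closedBall x 1, Metric.closedBall_mem_nhds x one_pos, ?_⟩
  have h1 := (hi (c1.toSchwartzMap (Complex.ofRealCLM.contDiff.comp χ.contDiff))).integrableOn
    (s := Metric.closedBall x 1)
  refine h1.congr_fun (fun y hy => ?_) Metric.isClosed_closedBall.measurableSet
  change ((χ y : ℝ) : ℂ) * M y = M y
  rw [χ.one_of_mem_closedBall hy, Complex.ofReal_one, one_mul]

theorem fourier_lineDerivOp_lineDerivOp_apply (G : 𝓢(E3, ℂ)) (m l ξ : E3) :
    𝓕 (∂_{m} (∂_{l} G)) ξ =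
      (2 * Real.pi * Complex.I) ^ 2 * (inner ℝ ξ m : ℝ) * (inner ℝ ξ l : ℝ) * 𝓕 G ξ := by
  have (m : E3) : (inner ℝ · m).HasTemperateGrowth := by fun_prop
  rw [fourier_lineDerivOp_eq, fourier_lineDerivOp_eq]
  simp [smulLeftCLM_apply_apply (this _)]
  ring

/-- The equation `I u = 0` is averaged over lines with the weight `ξ_j ξ_k 𝓕 g(ξ)`, where `g` is the
ellipsoidal test function. On the Fourier side this weight is the Hessian of `g`, whose integrals
along rays are known, so `U y` is orthogonal to the matrix `B - (B y)(B y)ᵀ / ⟪B y, y⟫` with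
`B = 1 + b bᵀ`. -/
theorem ae_stretch_eq_zero {u : TensorField} {U : E3 → Matrix (Fin 3) (Fin 3) ℂ}
    (hum : ∀ j k, Measurable fun x => u x j k) (hUm : ∀ j k, Measurable fun y => U y j k)
    (hU : IsTensorFT u U) (h : RayTransformVanishes u) (b : E3) :
    ∀ᵐ y : E3, ∑ j, ∑ k, U y j k *
      ((stretch b (EuclideanSpace.single j 1) k -
        stretch b y j * stretch b y k / stretchForm b y : ℝ) : ℂ) = 0 := by
  let e : Fin 3 → E3 := fun j => EuclideanSpace.single j 1
  let G : Fin 3 → Fin 3 → 𝓢(E3, ℂ) := fun j k => ∂_{e j} (∂_{e k} (ellipsoidTest b))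
  have hin : ∀ (y : E3) (k : Fin 3), inner ℝ y (e k) = y k := by
    intro y k; simp [e, EuclideanSpace.inner_single_right]
  have humc : ∀ j k, Measurable fun x => (u x j k : ℂ) := fun j k =>
    Complex.measurable_ofReal.comp (hum j k)
  let M : E3 → ℂ := fun y => ∑ j, ∑ k, U y j k * ∫ t : ℝ, G j k (t • y)
  have hθM : ∀ (θ : 𝓢(E3, ℂ)) (y : E3), θ y * M y =
      ∑ j, ∑ k, θ y * U y j k * ∫ t : ℝ, G j k (t • y) := fun θ y => by
    simp only [M, Finset.mul_sum, mul_assoc]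
  have hi : ∀ (θ : 𝓢(E3, ℂ)) j k, Integrable fun y => θ y * U y j k * ∫ t : ℝ, G j k (t • y) :=
    fun θ j k => integrable_schwartz_mul_integral_ray (hUm j k) (hU j k).2 θ (G j k)
  have hM : M =ᵐ[volume] 0 := by
    refine ae_eq_zero_of_integrable_schwartz_mul (fun θ => ?_) fun θ => ?_
    · simp only [hθM]
      exact integrable_finsetSum _ fun j _ => integrable_finsetSum _ fun k _ => hi θ j k
    simp only [hθM]
    rw [integral_finsetSum _ fun j _ => integrable_finsetSum _ fun k _ => hi θ j k,
      Finset.sum_congr rfl fun j _ => integral_finsetSum _ fun k _ => hi θ j k]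
    have hpair : ∀ j k, ∫ y, θ y * U y j k * ∫ t : ℝ, G j k (t • y) =
        ∫ p : E3 × E3, 𝓕 θ p.1 * 𝓕 (G j k) p.2 * ∫ t : ℝ, (u (p.1 + t • p.2) j k : ℂ) := by
      intro j k
      rw [(hU j k).integral_pairing_line (humc j k) (hUm j k), fourierInv_fourier_eq,
        fourierInv_fourier_eq]
    have hi' : ∀ j k, Integrable fun p : E3 × E3 =>
        𝓕 θ p.1 * 𝓕 (G j k) p.2 * ∫ t : ℝ, (u (p.1 + t • p.2) j k : ℂ) := fun j k =>
      integrable_schwartz_mul_integral_line (humc j k) (hU j k).1 _ _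
    simp only [hpair]
    rw [Finset.sum_congr rfl fun j _ => (integral_finsetSum _ fun k _ => hi' j k).symm,
      ← integral_finsetSum _ fun j _ => integrable_finsetSum _ fun k _ => hi' j k]
    refine integral_eq_zero_of_ae ?_
    filter_upwards [h, ae_all_iff.2 fun j => ae_all_iff.2 fun k =>
      ae_integrable_line (humc j k) (hU j k).1] with p hp hint
    have h1 : ∑ j, ∑ k, ((p.2 j : ℂ) * p.2 k) * ∫ t : ℝ, (u (p.1 + t • p.2) j k : ℂ) = 0 := by
      have h2 : (rayTransform u p.1 p.2 : ℂ) = 0 := by rw [hp.2, Complex.ofReal_zero]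
      rw [← h2, rayTransform, ← integral_complex_ofReal]
      simp only [← integral_const_mul]
      rw [Finset.sum_congr rfl fun j _ =>
          (integral_finsetSum _ fun k _ => (hint j k).const_mul _).symm,
        ← integral_finsetSum _ fun j _ => integrable_finsetSum _ fun k _ => (hint j k).const_mul _]
      refine integral_congr_ae (Eventually.of_forall fun t => ?_)
      simp only [rayIntegrand]
      push_cast
      exact Finset.sum_congr rfl fun j _ => Finset.sum_congr rfl fun k _ => by ring
    have h3 := congrArg (fun z => 𝓕 θ p.1 * ((2 * Real.pi * Complex.I) ^ 2 *
      𝓕 (ellipsoidTest b) p.2) * z) h1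
    simp only [mul_zero, Finset.mul_sum] at h3
    rw [Pi.zero_apply, ← h3]
    refine Finset.sum_congr rfl fun j _ => Finset.sum_congr rfl fun k _ => ?_
    rw [fourier_lineDerivOp_lineDerivOp_apply, hin, hin]
    ring
  filter_upwards [hM, Measure.ae_ne volume (0 : E3)] with y hy hy0
  have hc := cutoffConst_ne_zero (stretchForm_pos b hy0)
  have hc2 : ((2 * cutoffConst (stretchForm b y) : ℝ) : ℂ) ≠ 0 := by
    exact_mod_cast mul_ne_zero two_ne_zero hc
  refine (mul_eq_zero.1 (?_ : ((2 * cutoffConst (stretchForm b y) : ℝ) : ℂ) * _ = 0)).resolve_left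
    hc2
  refine Eq.trans ?_ hy
  rw [Finset.mul_sum]
  refine Finset.sum_congr rfl fun j _ => ?_
  rw [Finset.mul_sum]
  refine Finset.sum_congr rfl fun k _ => ?_
  rw [integral_lineDerivOp_ellipsoidTest b (e j) (e k) hy0]
  simp only [hin]
  push_cast
  ring

/-- The trace and the form `b ↦ U(b, b)`, projected to the complement of `y`, are separated by
comparing the test functions for `b` and for `0`. -/
theorem vanishesOnOrthogonal_of_measurable {u : TensorField}
    {U : E3 → Matrix (Fin 3) (Fin 3) ℂ}
    (hum : ∀ j k, Measurable fun x => u x j k) (hUm : ∀ j k, Measurable fun y => U y j k)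
    (hU : IsTensorFT u U) (h : RayTransformVanishes u) : VanishesOnOrthogonal U := by
  -- `Q y b` is `‖y‖²` times `U y` at the projection of `b` to the complement of `y`
  let Q : E3 → E3 → ℂ := fun y b => ∑ j, ∑ k, U y j k *
    ((‖y‖ ^ 2 * (b j * b k) - inner ℝ b y * (y j * b k + b j * y k) +
      inner ℝ b y ^ 2 * (y j * y k) / ‖y‖ ^ 2 : ℝ) : ℂ)
  have hQ : ∀ᵐ y, ∀ b, Q y b = 0 := by
    refine ae_forall_eq_zero_of_continuous (fun y => ?_) fun b => ?_
    · simp only [Q]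
      fun_prop
    filter_upwards [ae_stretch_eq_zero hum hUm hU h 0, ae_stretch_eq_zero hum hUm hU h b,
      Measure.ae_ne volume (0 : E3)] with y h0 hb hy0
    have hr : ‖y‖ ^ 2 ≠ 0 := pow_ne_zero _ (norm_ne_zero_iff.2 hy0)
    have hq : ‖y‖ ^ 2 + inner ℝ b y ^ 2 ≠ 0 := (stretchForm_pos b hy0).ne'
    have h1 := congrArg (((‖y‖ ^ 2 + inner ℝ b y ^ 2 : ℝ) : ℂ) * ·) hb
    have h2 := congrArg (((‖y‖ ^ 2 + inner ℝ b y ^ 2 : ℝ) : ℂ) * ·) h0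
    simp only [mul_zero] at h1 h2
    rw [← sub_eq_zero.2 (h1.trans h2.symm), Finset.mul_sum, Finset.mul_sum,
      ← Finset.sum_sub_distrib]
    refine Finset.sum_congr rfl fun j _ => ?_
    rw [Finset.mul_sum, Finset.mul_sum, ← Finset.sum_sub_distrib]
    refine Finset.sum_congr rfl fun k _ => ?_
    have e0 : ∀ b : E3, stretch b (EuclideanSpace.single j 1) k =
        (EuclideanSpace.single j 1 : E3) k + b j * b k := fun b => by
      simp [stretch, EuclideanSpace.inner_single_right]
    have e1 : ∀ (b : E3) (i : Fin 3), stretch b y i = y i + inner ℝ b y * b i := fun b i => by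
      simp [stretch]
    have key : ‖y‖ ^ 2 * (b j * b k) - inner ℝ b y * (y j * b k + b j * y k) +
        inner ℝ b y ^ 2 * (y j * y k) / ‖y‖ ^ 2 =
        (‖y‖ ^ 2 + inner ℝ b y ^ 2) * (stretch b (EuclideanSpace.single j 1) k -
          stretch b y j * stretch b y k / stretchForm b y) -
        (‖y‖ ^ 2 + inner ℝ b y ^ 2) * (stretch 0 (EuclideanSpace.single j 1) k -
          stretch 0 y j * stretch 0 y k / stretchForm 0 y) := by
      rw [e0, e0, e1, e1, e1, e1]
      simp only [stretchForm, inner_zero_left, PiLp.zero_apply]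
      field_simp
      ring
    rw [key, Complex.ofReal_sub, Complex.ofReal_mul, Complex.ofReal_mul]
    ring
  filter_upwards [hQ, Measure.ae_ne volume (0 : E3)] with y hy hy0 w hw
  have hr : ((‖y‖ ^ 2 : ℝ) : ℂ) ≠ 0 := by
    exact_mod_cast pow_ne_zero 2 (norm_ne_zero_iff.2 hy0)
  refine (mul_eq_zero.1 (?_ : ((‖y‖ ^ 2 : ℝ) : ℂ) * _ = 0)).resolve_left hr
  rw [← hy w, Finset.mul_sum]
  refine Finset.sum_congr rfl fun j _ => ?_
  rw [Finset.mul_sum]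
  refine Finset.sum_congr rfl fun k _ => ?_
  rw [hw]
  push_cast
  ring

/-- The Fourier transform at `y` of an `L²` tensor field in the kernel of the ray transform
vanishes on the complement of `y`. -/
theorem vanishesOnOrthogonal_of_rayTransformVanishes {u : TensorField}
    {U : E3 → Matrix (Fin 3) (Fin 3) ℂ} (hU : IsTensorFT u U) (h : RayTransformVanishes u) :
    VanishesOnOrthogonal U := by
  obtain ⟨u', hm, hu⟩ := exists_measurable_rep (u := u) fun j k => by
    simpa using (hU j k).1.re
  let U' : E3 → Matrix (Fin 3) (Fin 3) ℂ := fun y => Matrix.of fun j k => (hU j k).2.1.mk _ y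
  have hUU : ∀ᵐ y, U y = U' y := by
    filter_upwards [ae_all_iff.2 fun j => ae_all_iff.2 fun k => (hU j k).2.1.ae_eq_mk] with y hy
    ext j k
    exact hy j k
  have := vanishesOnOrthogonal_of_measurable hm
    (fun j k => (hU j k).2.1.stronglyMeasurable_mk.measurable)
    ((hU.congr_left hu).congr hUU) (RayTransformVanishes.congr h hu)
  filter_upwards [this, hUU] with y hy he
  rwa [he]

/-! ### Solenoidal fields in the kernel of the modified ray transform -/

/-- On the Fourier side, an `L²` field lies in the kernel of the ray transform exactly when it is
a potential field. -/
theorem rayTransformVanishes_iff {u : TensorField} {U : E3 → Matrix (Fin 3) (Fin 3) ℂ}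
    (hU : IsTensorFT u U) : RayTransformVanishes u ↔ VanishesOnOrthogonal U :=
  ⟨vanishesOnOrthogonal_of_rayTransformVanishes hU, rayTransformVanishes_of_vanishesOnOrthogonal hU⟩

theorem eq_zero_of_forall_quadratic_eq_zero {N : Matrix (Fin 3) (Fin 3) ℂ}
    (hs : ∀ j k, N j k = N k j) (h : ∀ e : E3, ∑ j, ∑ k, N j k * e j * e k = 0) : N = 0 := by
  have h' : ∀ a b c : ℝ, N 0 0 * a * a + N 1 1 * b * b + N 2 2 * c * c + 2 * N 0 1 * a * b +
      2 * N 0 2 * a * c + 2 * N 1 2 * b * c = 0 := by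
    intro a b c
    have := h !₂[a, b, c]
    simp only [Fin.sum_univ_three] at this
    simp [hs 1 0, hs 2 0, hs 2 1] at this
    linear_combination this
  have h00 := h' 1 0 0
  have h11 := h' 0 1 0
  have h22 := h' 0 0 1
  have h01 := h' 1 1 0
  have h02 := h' 1 0 1
  have h12 := h' 0 1 1
  simp at h00 h11 h22 h01 h02 h12
  simp only [h00, h11, h22, zero_add, mul_eq_zero, OfNat.ofNat_ne_zero, false_or] at h01 h02 h12
  ext j k
  fin_cases j <;> fin_cases k <;> simp [h00, h11, h22, h01, h02, h12, hs 1 0, hs 2 0, hs 2 1]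

/-- A symmetric matrix annihilating `y` is determined by its quadratic form on the complement
of `y`. -/
theorem eq_smul_orthProj {M : Matrix (Fin 3) (Fin 3) ℂ} {y : E3} (hy : y ≠ 0)
    (hs : ∀ j k, M j k = M k j) (hM : ∀ j, ∑ k, M j k * (y k : ℂ) = 0) {c : ℂ}
    (h : ∀ w : E3, inner ℝ w y = 0 →
      ∑ j, ∑ k, (M j k + if j = k then c else 0) * w j * w k = 0) (j k : Fin 3) :
    M j k = -c * (orthProj y j k : ℂ) := by
  have hn : ‖y‖ ^ 2 ≠ 0 := pow_ne_zero _ (norm_ne_zero_iff.2 hy)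
  have hρ : (((‖y‖ ^ 2)⁻¹ : ℝ) : ℂ) * (y 0 * y 0 + y 1 * y 1 + y 2 * y 2) = 1 := by
    have := inv_mul_cancel₀ hn
    nth_rw 2 [← sum_coord_sq] at this
    rw [Fin.sum_univ_three] at this
    exact_mod_cast this
  have h0 := hM 0
  have h1 := hM 1
  have h2 := hM 2
  have hN : (Matrix.of fun j k => M j k + c * (orthProj y j k : ℂ)) = 0 := by
    refine eq_zero_of_forall_quadratic_eq_zero (fun j k => ?_) fun e => ?_
    · simp only [Matrix.of_apply, hs j k, orthProj_symm y j k]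
    -- project `e` to the complement of `y`
    have hw := h (e - (inner ℝ e y * (‖y‖ ^ 2)⁻¹) • y) (by
      rw [inner_sub_left, real_inner_smul_left, real_inner_self_eq_norm_sq, mul_assoc,
        inv_mul_cancel₀ hn, mul_one, sub_self])
    have hin : inner ℝ e y = e 0 * y 0 + e 1 * y 1 + e 2 * y 2 := by
      simp [PiLp.inner_apply, Fin.sum_univ_three, mul_comm]
    rw [hin] at hw
    simp only [Fin.sum_univ_three, Matrix.of_apply, orthProj, PiLp.sub_apply, PiLp.smul_apply,
      smul_eq_mul, hs 1 0, hs 2 0, hs 2 1] at h0 h1 h2 hw ⊢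
    generalize (‖y‖ ^ 2)⁻¹ = ρ at hw hρ ⊢
    simp at hw ⊢
    set d : ℂ := e 0 * y 0 + e 1 * y 1 + e 2 * y 2 with hd
    linear_combination hw + ρ * d * (2 * e 0 - ρ * d * y 0) * h0 +
      ρ * d * (2 * e 1 - ρ * d * y 1) * h1 + ρ * d * (2 * e 2 - ρ * d * y 2) * h2 -
      c * d ^ 2 * ρ * hρ
  have := congrFun (congrFun hN j) k
  simp only [Matrix.of_apply, Matrix.zero_apply] at this
  linear_combination this

theorem IsTensorFT.trace {f : TensorField} {F : E3 → Matrix (Fin 3) (Fin 3) ℂ}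
    (hF : IsTensorFT f F) : IsFourierPair (fun x => ((f x).trace : ℂ)) fun y => (F y).trace := by
  have := IsFourierPair.sum Finset.univ fun j _ => hF j j
  simpa [Matrix.trace] using this

theorem IsTensorFT.add_scalarTensor {f : TensorField} {F : E3 → Matrix (Fin 3) (Fin 3) ℂ}
    (hF : IsTensorFT f F) {α : E3 → ℝ} {A : E3 → ℂ} (hA : IsFourierPair (fun x => (α x : ℂ)) A)
    (c : ℝ) : IsTensorFT (fun x => f x + (c * α x) • (1 : Matrix (Fin 3) (Fin 3) ℝ))
      fun y => Matrix.of fun j k => F y j k + if j = k then c * A y else 0 := by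
  intro j k
  by_cases hjk : j = k
  · subst hjk
    simpa using (hF j j).add (hA.const_mul c)
  · simpa [hjk] using hF j k

theorem IsTensorFT.symm {f : TensorField} {F : E3 → Matrix (Fin 3) (Fin 3) ℂ}
    (hF : IsTensorFT f F) (hf : ∀ᵐ x, (f x).IsSymm) : ∀ᵐ y, ∀ j k, F y j k = F y k j := by
  refine ae_all_iff.2 fun j => ae_all_iff.2 fun k => (hF j k).unique_right
    ((hF k j).congr ?_ EventuallyEq.rfl)
  filter_upwards [hf] with x hx
  rw [hx.apply]

/-- If `f` is solenoidal and `f + c α g` is potential, then `f` is the projection of `-c α g`. -/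
theorem ae_eq_smul_orthProj {f : TensorField} {F : E3 → Matrix (Fin 3) (Fin 3) ℂ}
    (hF : IsTensorFT f F) (hf : ∀ᵐ x, (f x).IsSymm) (hs : IsSolenoidal f) {A : E3 → ℂ} {c : ℝ}
    (hv : VanishesOnOrthogonal fun y => Matrix.of fun j k =>
      F y j k + if j = k then c * A y else 0) :
    ∀ᵐ y, F y = Matrix.of fun j k => -(c * A y) * (orthProj y j k : ℂ) := by
  filter_upwards [hF.symm hf, (isSolenoidal_iff hF).1 hs, hv, Measure.ae_ne volume (0 : E3)]
    with y h1 h2 h3 hy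
  ext j k
  exact eq_smul_orthProj hy h1 h2 h3 j k

theorem trace_smul_orthProj {y : E3} (hy : y ≠ 0) (c : ℂ) :
    (Matrix.of fun j k => c * (orthProj y j k : ℂ)).trace = c * 2 := by
  have := congrArg ((↑) : ℝ → ℂ) (trace_orthProj hy)
  simp only [Matrix.trace, Matrix.diag, Matrix.of_apply, ← Finset.mul_sum] at this ⊢
  push_cast at this
  rw [this]

theorem isTensorFT_addTrace {f : TensorField} {F : E3 → Matrix (Fin 3) (Fin 3) ℂ}
    (hF : IsTensorFT f F) (a : ℝ) : IsTensorFT (addTrace a f)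
      fun y => Matrix.of fun j k => F y j k + if j = k then a * (F y).trace else 0 :=
  hF.add_scalarTensor hF.trace a

/-- The transform of `f` is the projection of `-a (tr f) g`. The projection has trace two, and
taking traces gives the second relation, in which `a = -1/2` is exceptional. -/
theorem ae_eq_of_rayTransformVanishes_addTrace {f : TensorField}
    {F : E3 → Matrix (Fin 3) (Fin 3) ℂ} (hF : IsTensorFT f F) (hf : ∀ᵐ x, (f x).IsSymm)
    (hs : IsSolenoidal f) {a : ℝ} (h : RayTransformVanishes (addTrace a f)) :
    ∀ᵐ y, F y = (Matrix.of fun j k => -(a * (F y).trace) * (orthProj y j k : ℂ)) ∧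
      (1 + 2 * a) * (F y).trace = 0 := by
  have hv := (rayTransformVanishes_iff (isTensorFT_addTrace hF a)).1 h
  filter_upwards [ae_eq_smul_orthProj hF hf hs hv, Measure.ae_ne volume (0 : E3)] with y h1 hy
  refine ⟨h1, ?_⟩
  have := congrArg Matrix.trace h1
  rw [trace_smul_orthProj hy] at this
  linear_combination this

theorem ae_eq_zero_of_rayTransformVanishes_addTrace {f : TensorField} (hf : IsSymmL2 f)
    (hs : IsSolenoidal f) {a : ℝ} (ha : a ≠ -(1 / 2))
    (h : RayTransformVanishes (addTrace a f)) : ∀ᵐ x, f x = 0 := by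
  obtain ⟨F, hF⟩ := exists_isTensorFT hf.1
  have ha' : (1 + 2 * a : ℂ) ≠ 0 := by
    have : 1 + 2 * a ≠ 0 := fun h0 => ha (by linarith)
    exact_mod_cast this
  have h0 : ∀ᵐ y, F y = 0 := by
    filter_upwards [ae_eq_of_rayTransformVanishes_addTrace hF hf.2 hs h] with y hy
    rw [hy.1, (mul_eq_zero.1 hy.2).resolve_left ha']
    ext j k
    simp
  have h1 : IsTensorFT (fun _ => 0) fun _ => 0 := fun j k => by
    simpa using IsFourierPair.zero (E := E3)
  exact (hF.congr h0).unique_left h1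

/-- In the exceptional case the scalar function is recovered from `f` as half of its trace. -/
theorem isSolenoidalPart_of_rayTransformVanishes {f : TensorField} (hf : IsSymmL2 f)
    (hs : IsSolenoidal f) (h : RayTransformVanishes (addTrace (-(1 / 2)) f)) :
    MemLp (fun x => 1 / 2 * (f x).trace) 2 volume ∧
      IsSolenoidalPart (scalarTensor fun x => 1 / 2 * (f x).trace) f := by
  obtain ⟨F, hF⟩ := exists_isTensorFT hf.1
  have hA : IsFourierPair (fun x => ((1 / 2 * (f x).trace : ℝ) : ℂ))
      fun y => 1 / 2 * (F y).trace := by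
    simpa using hF.trace.const_mul (1 / 2)
  refine ⟨by simpa using hA.1.re, isSolenoidalPart_of_isTensorFT hA (hF.congr ?_)⟩
  filter_upwards [ae_eq_of_rayTransformVanishes_addTrace hF hf.2 hs h] with y hy
  refine hy.1.trans ?_
  ext j k
  simp

/-- The solenoidal part of `α g` is the projection of `α g` on the Fourier side. -/
theorem _root_.IsSolenoidalPart.isTensorFT {α : E3 → ℝ} {A : E3 → ℂ} {f : TensorField}
    (h : IsSolenoidalPart (scalarTensor α) f) (hA : IsFourierPair (fun x => (α x : ℂ)) A) :
    IsTensorFT f fun y => Matrix.of fun j k => A y * (orthProj y j k : ℂ) := by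
  obtain ⟨hf, hs, v, hv, -, hd⟩ := h
  obtain ⟨F, hF⟩ := exists_isTensorFT hf.1
  have hdF : IsTensorFT (fun x => scalarTensor α x - f x) fun y => -Matrix.of fun j k =>
      F y j k + if j = k then (-1 : ℝ) * A y else 0 := by
    intro j k
    refine (((hF.add_scalarTensor hA (-1)) j k).const_mul (-1)).congr
      (Eventually.of_forall fun x => ?_) (Eventually.of_forall fun y => ?_)
    · simp [scalarTensor, sub_eq_add_neg, add_comm]
    · simp
  have hv' : VanishesOnOrthogonal fun y => Matrix.of fun j k =>
      F y j k + if j = k then (-1 : ℝ) * A y else 0 := by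
    filter_upwards [vanishesOnOrthogonal_of_isInnerDeriv hv hd hdF] with y hy w hw
    have := hy w hw
    simp only [Matrix.neg_apply, neg_mul, Finset.sum_neg_distrib, neg_eq_zero] at this
    exact this
  refine hF.congr ?_
  filter_upwards [ae_eq_smul_orthProj hF hf.2 hs hv'] with y hy
  rw [hy]
  ext j k
  simp

theorem _root_.IsSolenoidalPart.trace_eq {α : E3 → ℝ} {f : TensorField} (hα : MemLp α 2 volume)
    (h : IsSolenoidalPart (scalarTensor α) f) : ∀ᵐ x, (f x).trace = 2 * α x := by
  obtain ⟨A, hA : IsFourierPair (fun x => (α x : ℂ)) A⟩ := exists_isFourierPair hα.ofReal (E := E3)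
  have h1 := (h.isTensorFT hA).trace
  have h2 := hA.const_mul 2
  have h3 : (fun y => (Matrix.of fun j k => A y * (orthProj y j k : ℂ)).trace) =ᵐ[volume]
      fun y => 2 * A y := by
    filter_upwards [Measure.ae_ne volume (0 : E3)] with y hy
    rw [trace_smul_orthProj hy, mul_comm]
  filter_upwards [(h1.congr EventuallyEq.rfl h3).unique_left h2] with x hx
  exact_mod_cast hx

theorem _root_.IsSolenoidalPart.rayTransformVanishes {α : E3 → ℝ} {f : TensorField}
    (hα : MemLp α 2 volume) (h : IsSolenoidalPart (scalarTensor α) f) :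
    RayTransformVanishes (addTrace (-(1 / 2)) f) := by
  obtain ⟨A, hA : IsFourierPair (fun x => (α x : ℂ)) A⟩ := exists_isFourierPair hα.ofReal (E := E3)
  have hF := h.isTensorFT hA
  rw [rayTransformVanishes_iff (isTensorFT_addTrace hF _)]
  filter_upwards [Measure.ae_ne volume (0 : E3)] with y hy w hw
  -- on the complement of `y` the projection is the identity
  rw [trace_smul_orthProj hy]
  have hin : inner ℝ w y = w 0 * y 0 + w 1 * y 1 + w 2 * y 2 := by
    simp [PiLp.inner_apply, Fin.sum_univ_three, mul_comm]
  rw [hin] at hw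
  have hw' : (w 0 * y 0 + w 1 * y 1 + w 2 * y 2 : ℂ) = 0 := by exact_mod_cast hw
  simp only [Fin.sum_univ_three, Matrix.of_apply, orthProj]
  generalize (‖y‖ ^ 2)⁻¹ = ρ
  simp
  linear_combination (-A y * ρ * (w 0 * y 0 + w 1 * y 1 + w 2 * y 2)) * hw'

theorem _root_.IsSolenoidalPart.unique {α : E3 → ℝ} {f f' : TensorField} (hα : MemLp α 2 volume)
    (h : IsSolenoidalPart (scalarTensor α) f) (h' : IsSolenoidalPart (scalarTensor α) f') :
    ∀ᵐ x, f' x = f x := by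
  obtain ⟨A, hA : IsFourierPair (fun x => (α x : ℂ)) A⟩ := exists_isFourierPair hα.ofReal (E := E3)
  exact (h'.isTensorFT hA).unique_left (h.isTensorFT hA)

theorem exists_isSolenoidalPart {α : E3 → ℝ} (hα : MemLp α 2 volume) :
    ∃ f, IsSolenoidalPart (scalarTensor α) f := by
  obtain ⟨A, hA : IsFourierPair (fun x => (α x : ℂ)) A⟩ := exists_isFourierPair hα.ofReal (E := E3)
  obtain ⟨f, hf⟩ := exists_tensor_of_orthProj hA
  exact ⟨f, isSolenoidalPart_of_isTensorFT hA hf⟩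

/-! ### A compactly supported field in the kernel -/

theorem isFourierPair_schwartz (φ : 𝓢(E3, ℂ)) : IsFourierPair φ (𝓕 φ : 𝓢(E3, ℂ)) := by
  have := isFourierPair_fourierInv (𝓕 φ).integrable ((𝓕 φ).memLp 2 (volume : Measure E3))
  rwa [← fourierInv_coe, fourierInv_fourier_eq] at this

/-- The second derivatives `∂_j ∂_k ψ` of a radial test function `ψ`. -/
noncomputable def bumpHess (j k : Fin 3) : 𝓢(E3, ℂ) :=
  ∂_{EuclideanSpace.single j (1 : ℝ)} (∂_{EuclideanSpace.single k (1 : ℝ)} (ellipsoidTest 0))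

/-- The field `(Δψ) g - ∇²ψ` for a radial test function `ψ`. It is solenoidal, and subtracting half
of its trace leaves the potential field `-∇²ψ`. -/
noncomputable def bumpField : TensorField := fun x => Matrix.of fun j k =>
  (if j = k then ∑ i, (bumpHess i i x).re else 0) - (bumpHess j k x).re

theorem ofReal_re_bumpHess (j k : Fin 3) (x : E3) : ((bumpHess j k x).re : ℂ) = bumpHess j k x := by
  rw [bumpHess, lineDerivOp_lineDerivOp_ellipsoidTest, Complex.ofReal_re]

theorem fourier_bumpHess (j k : Fin 3) (y : E3) : 𝓕 (bumpHess j k) y =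
    (2 * Real.pi * Complex.I) ^ 2 * (y j * y k) * 𝓕 (ellipsoidTest 0) y := by
  rw [bumpHess, fourier_lineDerivOp_lineDerivOp_apply]
  simp [EuclideanSpace.inner_single_right, mul_assoc]

theorem isTensorFT_bumpField : IsTensorFT bumpField fun y => Matrix.of fun j k =>
    (2 * Real.pi * Complex.I) ^ 2 * 𝓕 (ellipsoidTest 0) y *
      ((if j = k then (y 0 * y 0 + y 1 * y 1 + y 2 * y 2 : ℂ) else 0) - y j * y k) := by
  intro j k
  have hH := fun j k => isFourierPair_schwartz (bumpHess j k)
  have h1 : IsFourierPair (fun x => if j = k then ∑ i, bumpHess i i x else 0)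
      (fun y => if j = k then ∑ i, 𝓕 (bumpHess i i) y else 0) := by
    by_cases hjk : j = k
    · simpa [hjk] using IsFourierPair.sum Finset.univ fun i _ => hH i i
    · simpa [hjk] using IsFourierPair.zero (E := E3)
  refine (h1.sub (hH j k)).congr (Eventually.of_forall fun x => ?_)
    (Eventually.of_forall fun y => ?_)
  · simp only [bumpField, Matrix.of_apply]
    split_ifs <;> simp [ofReal_re_bumpHess]
  · simp only [fourier_bumpHess, Fin.sum_univ_three, Matrix.of_apply]
    split_ifs <;> ring

theorem hasCompactSupport_bumpField : HasCompactSupport bumpField := by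
  refine HasCompactSupport.of_support_subset_isCompact
    (isCompact_closedBall (0 : E3) 2) fun x hx => ?_
  by_contra hc
  rw [mem_closedBall_zero_iff, not_le] at hc
  have hq : 2 < stretchForm 0 x := by
    simp only [stretchForm, inner_zero_left]
    nlinarith
  refine hx ?_
  have h0 : ∀ j k, bumpHess j k x = 0 := fun j k => by
    rw [bumpHess, lineDerivOp_lineDerivOp_ellipsoidTest, deriv_cutoff_of_two_lt hq,
      deriv_deriv_cutoff_of_two_lt hq]
    simp
  ext j k
  simp [bumpField, h0]

theorem isSymmL2_bumpField : IsSymmL2 bumpField := by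
  refine ⟨fun j k => by simpa using (isTensorFT_bumpField j k).1.re,
    Eventually.of_forall fun x => ?_⟩
  ext j k
  simp [bumpField, bumpHess, lineDerivOp_comm (ellipsoidTest 0) (EuclideanSpace.single k 1),
    eq_comm (a := j)]

theorem isSolenoidal_bumpField : IsSolenoidal bumpField := by
  refine (isSolenoidal_iff isTensorFT_bumpField).2 (Eventually.of_forall fun y j => ?_)
  simp only [Matrix.of_apply, Fin.sum_univ_three]
  fin_cases j <;> simp <;> ring

theorem rayTransformVanishes_bumpField : RayTransformVanishes (addTrace (-(1 / 2)) bumpField) := by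
  rw [rayTransformVanishes_iff (isTensorFT_addTrace isTensorFT_bumpField _)]
  refine Eventually.of_forall fun y w hw => ?_
  have hin : inner ℝ w y = w 0 * y 0 + w 1 * y 1 + w 2 * y 2 := by
    simp [PiLp.inner_apply, Fin.sum_univ_three, mul_comm]
  rw [hin] at hw
  have hw' : (w 0 * y 0 + w 1 * y 1 + w 2 * y 2 : ℂ) = 0 := by exact_mod_cast hw
  simp only [Fin.sum_univ_three, Matrix.of_apply, Matrix.trace, Matrix.diag]
  generalize (2 * Real.pi * Complex.I) ^ 2 * 𝓕 (ellipsoidTest 0) y = c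
  simp
  linear_combination (-c * (w 0 * y 0 + w 1 * y 1 + w 2 * y 2)) * hw'

theorem not_ae_eq_zero_bumpField : ¬ ∀ᵐ x, bumpField x = 0 := by
  intro h
  -- otherwise the Fourier transform of the test function vanishes
  have h1 := (isTensorFT_bumpField.congr_left h).trace
  have h2 := h1.unique_right (U' := fun _ => 0) (by simpa using IsFourierPair.zero (E := E3))
  have h3 : (𝓕 (ellipsoidTest 0) : 𝓢(E3, ℂ)) =ᵐ[volume] fun _ => 0 := by
    filter_upwards [h2, Measure.ae_ne volume (0 : E3)] with y hy hy0
    have hn : (y 0 * y 0 + y 1 * y 1 + y 2 * y 2 : ℂ) ≠ 0 := by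
      have := sum_coord_sq y
      rw [Fin.sum_univ_three] at this
      have hy' := pow_ne_zero 2 (norm_ne_zero_iff.2 hy0)
      rw [← this] at hy'
      exact_mod_cast hy'
    have : (2 * Real.pi * Complex.I) ^ 2 * 2 * (y 0 * y 0 + y 1 * y 1 + y 2 * y 2) *
        𝓕 (ellipsoidTest 0) y = 0 := by
      rw [← hy]
      simp only [Fin.sum_univ_three, Matrix.of_apply, Matrix.trace, Matrix.diag]
      simp
      ring
    exact (mul_eq_zero.1 this).resolve_left
      (mul_ne_zero (mul_ne_zero (pow_ne_zero _ Complex.two_pi_I_ne_zero) two_ne_zero) hn)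
  have h4 := ((isFourierPair_schwartz (ellipsoidTest 0)).congr EventuallyEq.rfl h3).unique_left
    IsFourierPair.zero
  have h5 := congrFun (Continuous.ae_eq_iff_eq volume (ellipsoidTest 0).continuous
    continuous_const |>.1 h4) 0
  change ((cutoff (stretchForm 0 0) : ℝ) : ℂ) = 0 at h5
  simp [stretchForm, cutoff, Real.smoothTransition.one_of_one_le] at h5

/-! ### The exceptional value of the constant -/

theorem manConstant_eq_iff {ν₁ ν₂ ν₃ ν₄ : ℝ} (hν : 1 + ν₃ + ν₄ ≠ 0) :
    manConstant ν₁ ν₂ ν₃ ν₄ = -(1 / 2) ↔ ν₁ + ν₂ + ν₃ + ν₄ = -1 := by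
  rw [manConstant, div_eq_iff (mul_ne_zero two_ne_zero hν)]
  constructor <;> intro h <;> linarith

end ElasticRay

open ElasticRay

theorem mainTheorem3 (ν₁ ν₂ ν₃ ν₄ : ℝ) (hν : 1 + ν₃ + ν₄ ≠ 0) :
    ((∀ f : TensorField, IsSymmL2 f → HasCompactSupport f → IsSolenoidal f →
        RayTransformVanishes (addTrace (manConstant ν₁ ν₂ ν₃ ν₄) f) →
        ∀ᵐ x : E3, f x = 0) ↔
      ν₁ + ν₂ + ν₃ + ν₄ ≠ -1) ∧
    (ν₁ + ν₂ + ν₃ + ν₄ = -1 →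
      (∀ f : TensorField, IsSymmL2 f → HasCompactSupport f → IsSolenoidal f →
        (RayTransformVanishes (addTrace (manConstant ν₁ ν₂ ν₃ ν₄) f) ↔
          ∃ α : E3 → ℝ, MemLp α 2 volume ∧ HasCompactSupport α ∧
            IsSolenoidalPart (scalarTensor α) f)) ∧
      (∀ f : TensorField, IsSymmL2 f → IsSolenoidal f →
        (RayTransformVanishes (addTrace (manConstant ν₁ ν₂ ν₃ ν₄) f) ↔
          ∃ α : E3 → ℝ, MemLp α 2 volume ∧ IsSolenoidalPart (scalarTensor α) f)) ∧
      (∀ α : E3 → ℝ, MemLp α 2 volume →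
        ∃ f : TensorField, IsSolenoidalPart (scalarTensor α) f ∧
          (∀ f' : TensorField, IsSolenoidalPart (scalarTensor α) f' → ∀ᵐ x : E3, f' x = f x) ∧
          ∀ᵐ x : E3, (f x).trace = 2 * α x)) := by
  have ha := manConstant_eq_iff (ν₁ := ν₁) (ν₂ := ν₂) hν
  refine ⟨⟨fun h hsum => ?_, fun hsum f hf _ hs h => ?_⟩, fun hsum => ?_⟩
  · rw [ha.2 hsum] at h
    exact not_ae_eq_zero_bumpField (h _ isSymmL2_bumpField hasCompactSupport_bumpField
      isSolenoidal_bumpField rayTransformVanishes_bumpField)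
  · exact ae_eq_zero_of_rayTransformVanishes_addTrace hf hs (mt ha.1 hsum) h
  · rw [ha.2 hsum]
    refine ⟨fun f hf hc hs => ⟨fun h => ?_, fun ⟨α, hα, _, h⟩ => h.rayTransformVanishes hα⟩,
      fun f hf hs => ⟨fun h => ?_, fun ⟨α, hα, h⟩ => h.rayTransformVanishes hα⟩,
      fun α hα => ?_⟩
    · obtain ⟨h1, h2⟩ := isSolenoidalPart_of_rayTransformVanishes hf hs h
      exact ⟨_, h1, hc.comp_left (g := fun M : Matrix (Fin 3) (Fin 3) ℝ => 1 / 2 * M.trace)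
        (by simp), h2⟩
    · exact ⟨_, isSolenoidalPart_of_rayTransformVanishes hf hs h⟩
    · obtain ⟨f, hf⟩ := exists_isSolenoidalPart hα
      exact ⟨f, hf, fun f' hf' => hf.unique hα hf', hf.trace_eq hα⟩
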